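/- **Setting.** There are $K\ge 3$ arms, $\mathcal A=\{1,\dots,K\}$, each a Markov chain on a common finite set $\mathcal S$; the chains are independent and all of them move at every time step. If $h$ is the odd arm, arm $a$ has transition matrix $P_h^a=P_1$ for $a=h$ and $P_h^a=P_2$ for $a\ne h$. Here $P_1\neq P_2$ are ergodic (irreducible and aperiodic) and $P_1(j|i)>0\iff P_2(j|i)>0$ for all $i,j$. The initial laws of the arms do not depend on $h$. Let $\eta\in(0,1]$. At each time $t\ge 0$ the decision maker intends an arm $B_t$, the arm $A_t$ is pulled with $P(A_t=a\mid B_t=b)=\frac{\eta}{K}+(1-\eta)\mathbb I_{\{a=b\}}$, and the state $\bar X_t$ of arm $A_t$ is observed. The policies start by a sweep with $A_t=t+1$ for $0\le t<K$, and the trembling rule applies from time $K$ on. For $t\ge K$ let $d_a(t)\ge 1$ be the time elapsed at $t$ since arm $a$ was last pulled, and $i_a(t)$ the state then observed; write $(\underline d(t),\underline i(t))$, a process in $\mathbb S=\{(\underline d,\underline i)\in\mathbb N^K\times\mathcal S^K:$ exactly one $d_a$ equals $1$, the others are $>1\}$. A family $\lambda=(\lambda(\cdot|\underline d,\underline i))_{(\underline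 d,\underline i)\in\mathbb S}$ of probability laws on $\mathcal A$ defines a stationary strategy in which $B_t\sim\lambda(\cdot|\underline d(t),\underline i(t))$. With odd arm $h$, let $\mu^\lambda$ be the stationary distribution of $(\underline d(t),\underline i(t))$ on $\mathbb S$ under it, and put $$\nu^\lambda(\underline d,\underline i,a)=\mu^\lambda(\underline d,\underline i)\Big(\tfrac{\eta}{K}+(1-\eta)\lambda(a|\underline d,\underline i)\Big),\qquad V_h(\lambda)=\min_{h'\ne h}\sum_{(\underline d,\underline i)\in\mathbb S}\sum_{a=1}^K\nu^\lambda(\underline d,\underline i,a)\,k_{hh'}(\underline d,\underline i,a),$$ where $k_{hh'}(\underline d,\underline i,a)$ is the relative entropy $D(P_1^{d_a}(\cdot|i_a)\|P_2^{d_a}(\cdot|i_a))$ if $a=h$, $D(P_2^{d_a}(\cdot|i_a)\|P_1^{d_a}(\cdot|i_a))$ if $a=h'$, and $0$ otherwise. Let $R^*(P_1,P_2)=\sup_\lambda V_h(\lambda)$. For $\delta>0$ and every $h\in\mathcal A$ let $\lambda_{h,\delta}$ be any $\lambda$ with $V_h(\lambda)\ge R^*(P_1,P_2)/(1+\delta)$.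 For $h\neq h'$ and $n\ge 0$ let $Z_{hh'}(n)=\log\dfrac{P_h(B^n,A^n,\bar X^n)}{P_{h'}(B^n,A^n,\bar X^n)}$ be the log-likelihood ratio of all intended pulls, actual pulls and observations at times $0,\dots,n$, and $M_h(n)=\min_{h'\ne h}Z_{hh'}(n)$. **Policy $\pi^\star(L,\delta)$** ($L>1$, $\delta>0$). After the initial sweep, at each time $n\ge K$: (1) let $\theta(n)$ be a maximiser of $g\mapsto M_g(n-1)$, ties being resolved uniformly at random; (2) if $M_{\theta(n)}(n-1)\ge\log((K-1)L)$, stop and declare $\theta(n)$; (3) otherwise draw $B_n\sim\lambda_{\theta(n),\delta}(\cdot|\underline d(n),\underline i(n))$. The non-stopping version always performs (3). The policy stops at the first time $n\ge K$ at which the condition in (2) holds. **Lemma.** Fix $L>1$, $\delta>0$ and $h\in\mathcal A$, and let $h$ be the odd arm. Under the non-stopping version of $\pi^\star(L,\delta)$, almost surely, for all $n\ge0$ and all $g,g'\in\mathcal A$, $$Z_{gg'}(n)=\sum_{t=0}^{\min(n,K-1)}\log\frac{P_g(X_t^{t+1}=\bar X_t)}{P_{g'}(X_t^{t+1}=\bar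 X_t)}+\sum_{t=K}^{n}\log\frac{(P_g^{A_t})^{d_{A_t}(t)}(\bar X_t\mid i_{A_t}(t))}{(P_{g'}^{A_t})^{d_{A_t}(t)}(\bar X_t\mid i_{A_t}(t))},$$ where $X_t^a$ is the state of arm $a$ at time $t$; this is the statistic that the policy computes. Moreover, for every $h'\neq h$, $$\liminf_{n\to\infty}\frac{Z_{hh'}(n)}{n}>0\quad\text{almost surely.}$$ Consequently, the policy $\pi^\star(L,\delta)$ stops in finite time with probability one. -/

import Mathlib

open MeasureTheory ProbabilityTheory Filter
open scoped ENNReal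

noncomputable section

namespace OddArm

/-- Data of the odd-arm problem with `K` arms (labelled by `Fin K`, i.e. `0, …, K - 1`) on the finite
state space `S`: the transition matrix `P₁` of the odd arm, the transition matrix `P₂` of every other
arm (the entry `P i j` is the probability of moving from `i` to `j`), the law `init a` of the state
of arm `a` at time `0` (it does not depend on which arm is odd), and the trembling-hand parameter
`η`. -/
structure Model (K : ℕ) (S : Type*) [Fintype S] [DecidableEq S] where
  P₁ : Matrix.rowStochastic ℝ S
  P₂ : Matrix.rowStochastic ℝ S
  init : Fin K → PMF S
  η : ℝ
  η_mem : η ∈ Set.Ioc (0 : ℝ) 1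

/-- A finite Markov chain is ergodic if it is irreducible and aperiodic: for each state `i` the
greatest common divisor of the possible return times to `i` is `1`. -/
def IsErgodic {S : Type*} [Fintype S] [DecidableEq S] (P : Matrix S S ℝ) : Prop :=
  P.IsIrreducible ∧
    ∀ i : S, ∀ k : ℕ, (∀ n : ℕ, 0 < n → 0 < (P ^ n) i i → k ∣ n) → k = 1

variable {K : ℕ} {S : Type*} [Fintype S] [DecidableEq S]

/-- The probability distribution in row `i` of a stochastic matrix. -/
def rowPMF (P : Matrix.rowStochastic ℝ S) (i : S) : PMF S :=
  PMF.ofFintype (fun j => ENNReal.ofReal ((P : Matrix S S ℝ) i j)) (by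
    rw [← ENNReal.ofReal_sum_of_nonneg
      (fun j _ => Matrix.nonneg_of_mem_rowStochastic P.2),
      Matrix.sum_row_of_mem_rowStochastic P.2, ENNReal.ofReal_one])

/-- Relative entropy `D(p ‖ q) = ∑ j, p j log (p j / q j)` on a finite set, with `0 log (0/0) = 0`. -/
def relEntropy (p q : S → ℝ) : ℝ := ∑ j, p j * Real.log (p j / q j)

namespace Model

/-- Transition matrix of arm `a` when arm `g` is the odd arm. -/
def arm (M : Model K S) (g a : Fin K) : Matrix.rowStochastic ℝ S :=
  if a = g then M.P₁ else M.P₂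

/-- `((P_g^a)^d)(j | i)`: the `d`-step transition probability of arm `a` from `i` to `j` when arm `g`
is the odd arm. -/
def armPow (M : Model K S) (g a : Fin K) (d : ℕ) (i j : S) : ℝ :=
  ((M.arm g a : Matrix S S ℝ) ^ d) i j

/-- Probability that arm `a` is in state `j` at time `t` when arm `g` is the odd arm. -/
def armMarginal (M : Model K S) (g a : Fin K) (t : ℕ) (j : S) : ℝ :=
  ∑ i, (M.init a i).toReal * M.armPow g a t i j

/-- The trembling hand: the law `η / K + (1 - η) 1{a = b}` of the pulled arm `a` when arm `b` is
intended. -/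
def tremble [NeZero K] (M : Model K S) (b : Fin K) : PMF (Fin K) :=
  PMF.ofFintype
    (fun a => ENNReal.ofReal (M.η / K + (1 - M.η) * (if a = b then 1 else 0))) (by
    have h0 : (0 : ℝ) ≤ M.η := M.η_mem.1.le
    have h1 : (0 : ℝ) ≤ 1 - M.η := sub_nonneg.2 M.η_mem.2
    have hK : (K : ℝ) ≠ 0 := Nat.cast_ne_zero.2 (NeZero.ne K)
    rw [← ENNReal.ofReal_sum_of_nonneg (fun a _ => by split_ifs <;> positivity),
      Finset.sum_add_distrib, ← Finset.mul_sum, Finset.sum_ite_eq' Finset.univ b]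
    simp only [Finset.sum_const, Finset.card_univ, Fintype.card_fin, nsmul_eq_mul,
      Finset.mem_univ, if_true]
    rw [mul_div_cancel₀ _ hK]
    simp)

end Model

/-! ### Delays, last observed states and stationary randomised strategies -/

/-- A pair `(d, i)` of a vector of arm delays and a vector of last observed states. -/
abbrev DelayState (K : ℕ) (S : Type*) : Type _ := (Fin K → ℕ) × (Fin K → S)

/-- The state space `𝕊`: exactly one delay equals `1` and all other delays are larger than `1`. -/
def validStates (K : ℕ) (S : Type*) : Set (DelayState K S) :=
  {s | ∃ a, s.1 a = 1 ∧ ∀ a', a' ≠ a → 1 < s.1 a'}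

/-- Update of delays and last observed states after arm `a` is pulled and seen in state `x`. -/
def updateState (s : DelayState K S) (a : Fin K) (x : S) : DelayState K S :=
  (fun a' => if a' = a then 1 else s.1 a' + 1, fun a' => if a' = a then x else s.2 a')

/-- A conditional law `λ(· | d, i)` on arms; it describes a stationary randomised strategy (SRS).
Only its values on `validStates` matter. -/
abbrev SRS (K : ℕ) (S : Type*) : Type _ := DelayState K S → PMF (Fin K)

namespace Model

/-- The law of the pulled arm, `η / K + (1 - η) λ(· | d, i)`, when the intended arm is drawn from
`λ(· | d, i)`. -/
def pulled [NeZero K] (M : Model K S) (lam : SRS K S) (s : DelayState K S) : PMF (Fin K) :=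
  (lam s).bind M.tremble

/-- One-step transition law of `(d(t), i(t))` under the SRS `λ` when arm `g` is odd: draw the pulled
arm `a`, draw its state from `((P_g^a)^{d_a})(· | i_a)`, and update. -/
def stateKernel [NeZero K] (M : Model K S) (g : Fin K) (lam : SRS K S) (s : DelayState K S) :
    PMF (DelayState K S) :=
  (M.pulled lam s).bind fun a =>
    (rowPMF (M.arm g a ^ s.1 a) (s.2 a)).map fun x => updateState s a x

/-- `μ` is a stationary distribution on `𝕊` of `(d(t), i(t))` under the SRS `λ` when arm `g` is
odd. -/
def IsStationary [NeZero K] (M : Model K S) (g : Fin K) (lam : SRS K S)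
    (μ : PMF (DelayState K S)) : Prop :=
  μ.support ⊆ validStates K S ∧ μ.bind (M.stateKernel g lam) = μ

/-- `k_{gg'}(d, i, a)`: the relative entropy between the laws of an observation of arm `a` with odd
arm `g` and with odd arm `g'`; it is `D(P₁^{d_a}(·|i_a) ‖ P₂^{d_a}(·|i_a))` for `a = g`,
`D(P₂^{d_a}(·|i_a) ‖ P₁^{d_a}(·|i_a))` for `a = g'`, and `0` otherwise. -/
def infoRate (M : Model K S) (g g' : Fin K) (s : DelayState K S) (a : Fin K) : ℝ :=
  if a = g then
    relEntropy (((M.P₁ : Matrix S S ℝ) ^ s.1 a) (s.2 a)) (((M.P₂ : Matrix S S ℝ) ^ s.1 a) (s.2 a))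
  else if a = g' then
    relEntropy (((M.P₂ : Matrix S S ℝ) ^ s.1 a) (s.2 a)) (((M.P₁ : Matrix S S ℝ) ^ s.1 a) (s.2 a))
  else 0

/-- `min_{g' ≠ g} ∑_{(d,i)} ∑_a ν(d,i,a) k_{gg'}(d,i,a)` with
`ν(d,i,a) = μ(d,i) (η / K + (1 - η) λ(a | d,i))`. -/
def srsValue [NeZero K] (M : Model K S) (g : Fin K) (lam : SRS K S)
    (μ : PMF (DelayState K S)) : ℝ≥0∞ :=
  ⨅ g' : Fin K, ⨅ _ : g' ≠ g,
    ∑' s : DelayState K S, ∑ a : Fin K,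
      μ s * M.pulled lam s a * ENNReal.ofReal (M.infoRate g g' s a)

/-- The constant `R*(P₁, P₂)`, computed with odd arm `g`: the supremum of `srsValue` over all SRS,
each with its stationary distribution. -/
def Rstar [NeZero K] (M : Model K S) (g : Fin K) : ℝ≥0∞ :=
  ⨆ lam : SRS K S, ⨆ μ : PMF (DelayState K S), ⨆ _ : M.IsStationary g lam μ, M.srsValue g lam μ

/-- `λ` is a possible choice of `λ_{g,δ}`: its value is at least `R*(P₁, P₂) / (1 + δ)`. -/
def IsNearOptimal [NeZero K] (M : Model K S) (g : Fin K) (δ : ℝ) (lam : SRS K S) : Prop :=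
  ∃ μ : PMF (DelayState K S), M.IsStationary g lam μ ∧
    M.Rstar g / ENNReal.ofReal (1 + δ) ≤ M.srsValue g lam μ

end Model

/-! ### Observed data and the test statistics -/

/-- What the decision maker records at one time: the intended arm `B`, the pulled arm `A`, and the
observed state `X̄` of the pulled arm. -/
abbrev Obs (K : ℕ) (S : Type*) : Type _ := Fin K × Fin K × S

/-- `(d(t), i(t))`, which depends on the records at times `< t` only. It is used only for `t ≥ K`,
when every arm has been pulled and the starting value at `t = 0` has been overwritten. -/
def delayState (o : ℕ → Obs K S) : ℕ → DelayState K S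
  | 0 => (fun _ => 0, fun _ => (o 0).2.2)
  | t + 1 => updateState (delayState o t) (o t).2.1 (o t).2.2

namespace Model

/-- Likelihood, with odd arm `g`, of the state observed at time `t` given the past and the pulled
arm `a = A_t`: during the initial sweep `t < K` it is the marginal law of arm `a` at time `t`, and
afterwards it is `((P_g^a)^{d_a(t)})(X̄_t | i_a(t))`. -/
def obsLik (M : Model K S) (g : Fin K) (o : ℕ → Obs K S) (t : ℕ) : ℝ :=
  if t < K then M.armMarginal g (o t).2.1 t (o t).2.2
  else M.armPow g (o t).2.1 ((delayState o t).1 (o t).2.1) ((delayState o t).2 (o t).2.1) (o t).2.2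

/-- The statistic `Z_{gg'}(n)`, a function of the records at times `0, …, n`. -/
def statZ (M : Model K S) (g g' : Fin K) (o : ℕ → Obs K S) (n : ℕ) : ℝ :=
  ∑ t ∈ Finset.range (n + 1), Real.log (M.obsLik g o t / M.obsLik g' o t)

/-- `M_g(n) = min_{g' ≠ g} Z_{gg'}(n)`. -/
def statM (M : Model K S) (g : Fin K) (o : ℕ → Obs K S) (n : ℕ) : ℝ :=
  ⨅ g' : {g' : Fin K // g' ≠ g}, M.statZ g g' o n

/-- The set `argmax_g M_g(n)`. -/
def bestGuesses (M : Model K S) (o : ℕ → Obs K S) (n : ℕ) : Finset (Fin K) :=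
  open Classical in
  Finset.univ.filter fun g => ∀ g', M.statM g' o n ≤ M.statM g o n

theorem bestGuesses_nonempty [NeZero K] (M : Model K S) (o : ℕ → Obs K S) (n : ℕ) :
    (M.bestGuesses o n).Nonempty := by
  obtain ⟨g, -, hg⟩ := Finset.exists_max_image Finset.univ (fun g => M.statM g o n)
    Finset.univ_nonempty
  exact ⟨g, by simpa [bestGuesses] using hg⟩

/-! ### The non-stopping policy and the law of the process -/

/-- Law of `(θ, B, A)` at time `n + 1` given the records at times `0, …, n`, where `Λ g` plays the
role of `λ_{g,δ}`. While `n + 1 < K` the arm with index `n + 1` is pulled. From time `K` on, `θ` is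
uniform on the maximisers of `M_g` (computed from the available records), the intended arm `B` is
drawn from `Λ θ (· | d, i)`, and `A` is the trembled version of `B`. -/
def actionLaw [NeZero K] (M : Model K S) (Λ : Fin K → SRS K S) (n : ℕ) (o : ℕ → Obs K S) :
    PMF (Fin K × Fin K × Fin K) :=
  if h : n + 1 < K then PMF.pure (⟨n + 1, h⟩, ⟨n + 1, h⟩, ⟨n + 1, h⟩)
  else
    (PMF.uniformOfFinset (M.bestGuesses o n) (M.bestGuesses_nonempty o n)).bind fun θ =>
      (Λ θ (delayState o (n + 1))).bind fun b =>
        (M.tremble b).map fun a => (θ, b, a)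

end Model

/-- Full configuration at one time: the states of all arms, and the triple `(θ, B, A)` of the current
guess, the intended arm and the pulled arm. -/
abbrev Config (K : ℕ) (S : Type*) : Type _ := (Fin K → S) × (Fin K × Fin K × Fin K)

/-- The current guess `θ`. -/
def Config.guess (c : Config K S) : Fin K := c.2.1

/-- The record `(B, A, X̄)`, with `X̄` the state of the pulled arm. -/
def Config.obs (c : Config K S) : Obs K S := (c.2.2.1, c.2.2.2, c.1 c.2.2.2)

/-- The sequence of records along a trajectory. -/
def records (ω : ℕ → Config K S) (t : ℕ) : Obs K S := Config.obs (ω t)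

/-- Extension of a finite history by its last entry. -/
def extend {X : Type*} {n : ℕ} (x : Finset.Iic n → X) (t : ℕ) : X :=
  x ⟨min t n, Finset.mem_Iic.2 (min_le_right t n)⟩

variable [MeasurableSpace S] [MeasurableSingletonClass S]

namespace Model

/-- One step of the whole system when arm `g` is odd: given the past, all arms move independently
according to their transition matrices, whether pulled or not, and `(θ, B, A)` is drawn according to
the policy from the past records. -/
def stepKernel [NeZero K] (M : Model K S) (Λ : Fin K → SRS K S) (g : Fin K) (n : ℕ) :
    Kernel (Finset.Iic n → Config K S) (Config K S) where
  toFun x :=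
    (Measure.pi fun a => (rowPMF (M.arm g a) ((extend x n).1 a)).toMeasure).prod
      (M.actionLaw Λ n (records (extend x))).toMeasure
  measurable' := Measurable.of_discrete

/-- Law of the configuration at time `0`: independent arms, and the arm with index `0` is pulled. -/
def startLaw [NeZero K] (M : Model K S) : Measure (Config K S) :=
  (Measure.pi fun a => (M.init a).toMeasure).prod
    (PMF.pure ((0 : Fin K), (0 : Fin K), (0 : Fin K))).toMeasure

instance [NeZero K] (M : Model K S) : IsProbabilityMeasure M.startLaw := by
  unfold startLaw; infer_instance

instance [NeZero K] (M : Model K S) (Λ : Fin K → SRS K S) (g : Fin K) (n : ℕ) :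
    IsMarkovKernel (M.stepKernel Λ g n) :=
  ⟨fun x => by
    change IsProbabilityMeasure ((Measure.pi fun a =>
      (rowPMF (M.arm g a) ((extend x n).1 a)).toMeasure).prod
        (M.actionLaw Λ n (records (extend x))).toMeasure)
    infer_instance⟩

/-- The law `P_g` of the whole trajectory under the non-stopping policy when arm `g` is odd. -/
def law [NeZero K] (M : Model K S) (Λ : Fin K → SRS K S) (g : Fin K) :
    Measure (ℕ → Config K S) :=
  Kernel.trajMeasure (X := fun _ => Config K S) M.startLaw (M.stepKernel Λ g)

/-- The log-likelihood ratio `log (P_g(B^n, A^n, X̄^n) / P_{g'}(B^n, A^n, X̄^n))` of all records up to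
time `n`. -/
def logLikRatio [NeZero K] (M : Model K S) (Λ : Fin K → SRS K S) (g g' : Fin K) (n : ℕ)
    (ω : ℕ → Config K S) : ℝ :=
  Real.log ((M.law Λ g).real {ω' | ∀ t ≤ n, records ω' t = records ω t} /
    (M.law Λ g').real {ω' | ∀ t ≤ n, records ω' t = records ω t})

/-- The stopping time of the policy with parameter `L`: the first decision time `n ≥ K` at which
`M_{θ(n)} ≥ log ((K - 1) L)`, where `M_{θ(n)}` is computed from the records before time `n`; it is
`⊤` if this never happens. -/
def stopTime (M : Model K S) (L : ℝ) (ω : ℕ → Config K S) : ℕ∞ :=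
  ⨅ n : ℕ, ⨅ _ : K ≤ n ∧
    Real.log (((K : ℝ) - 1) * L) ≤ M.statM (Config.guess (ω n)) (records ω) (n - 1), (n : ℕ∞)

end Model

end OddArm

end

/-! Given the records, the hidden states of the arms are independent: the state of the arm just
pulled is known, and every other arm has moved by its own transition matrix since it was last seen.
This filter (`lintegral_law_filter`) factors the probability of a record sequence into policy terms,
which do not depend on the odd arm, and predictive probabilities of the observed states
(`law_cylinder`). In a likelihood ratio the policy terms cancel. What remains is the test statistic,
because after the sweep the predictive laws are the `d`-step transition laws; the common support
keeps all ratios finite and nonzero (`logLikRatio_eq_statZ`).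

Linear growth comes from the mean, under `h`, of the square root of the likelihood ratio of `h'`
against `h`. Over a block of times it is multiplied, conditionally on the past, by an affinity that
is at most `1`. The point is to find one block length for which the affinity is at most some `ρ <
1`, whatever the past (`exists_affinity_le`). One observation need not discriminate, since `P₁ ^ d`
and `P₂ ^ d` may share rows; but `P₁` and `P₂` differ in some row `i`. Since the trembling hand
gives every arm probability at least `η / K`, with probability bounded below `h'` is pulled until,
by ergodicity, both candidate laws of arm `h` charge `i`, and then `h` is pulled twice. If the first
of these pulls shows `i`, the second compares row `i` of `P₁` with row `i` of `P₂`. All other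
courses of events contribute affinity at most `1`.

Hence the mean decays geometrically, and Markov's inequality with Borel–Cantelli gives linear growth
of every `Z_{hh'}`. So `M_h` tends to infinity, and `M_θ ≥ M_h` for the maximising guess `θ`, which
forces the policy to stop. -/

noncomputable section

namespace OddArm

/-! ### Laws on a finite set and the Bhattacharyya coefficient -/

section FiniteLaws

variable {S : Type*} [Fintype S]

theorem toReal_bind (p : PMF S) (q : S → PMF S) (j : S) :
    (p.bind q j).toReal = ∑ i, (p i).toReal * (q i j).toReal := by
  rw [PMF.bind_apply, tsum_fintype, ENNReal.toReal_sum]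
  · simp
  · exact fun i _ => ENNReal.mul_ne_top (p.apply_ne_top i) ((q i).apply_ne_top j)

theorem sum_toReal (p : PMF S) : ∑ i, (p i).toReal = 1 := by
  rw [← ENNReal.toReal_sum fun i _ => p.apply_ne_top i,
    ← tsum_fintype (L := SummationFilter.unconditional S), p.tsum_coe, ENNReal.toReal_one]

/-- The Bhattacharyya coefficient `∑ i, √(p i * q i)` of two laws. -/
def bhattacharyya (p q : PMF S) : ℝ := ∑ i, √((p i).toReal * (q i).toReal)

/-- Expansion of the squared Hellinger distance; it shows at once that the coefficient is at most
`1`, with equality only for equal laws. -/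
theorem bhattacharyya_eq (p q : PMF S) :
    bhattacharyya p q = 1 - (∑ i, (√(p i).toReal - √(q i).toReal) ^ 2) / 2 := by
  have h : ∑ i, (√(p i).toReal - √(q i).toReal) ^ 2 =
      ∑ i, (p i).toReal + ∑ i, (q i).toReal - 2 * bhattacharyya p q := by
    rw [bhattacharyya, Finset.mul_sum, ← Finset.sum_add_distrib, ← Finset.sum_sub_distrib]
    refine Finset.sum_congr rfl fun i _ => ?_
    rw [sub_sq, Real.sq_sqrt ENNReal.toReal_nonneg, Real.sq_sqrt ENNReal.toReal_nonneg,
      Real.sqrt_mul ENNReal.toReal_nonneg]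
    ring
  rw [h, sum_toReal, sum_toReal]
  ring

theorem bhattacharyya_le_one (p q : PMF S) : bhattacharyya p q ≤ 1 := by
  rw [bhattacharyya_eq]
  have : 0 ≤ ∑ i, (√(p i).toReal - √(q i).toReal) ^ 2 := Finset.sum_nonneg fun _ _ => sq_nonneg _
  linarith

theorem bhattacharyya_lt_one {p q : PMF S} (h : p ≠ q) : bhattacharyya p q < 1 := by
  rw [bhattacharyya_eq]
  obtain ⟨i, hi⟩ : ∃ i, p i ≠ q i := by
    by_contra! hpq
    exact h (PMF.ext hpq)
  have : 0 < ∑ i, (√(p i).toReal - √(q i).toReal) ^ 2 := by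
    refine Finset.sum_pos' (fun _ _ => sq_nonneg _) ⟨i, Finset.mem_univ i, ?_⟩
    refine sq_pos_of_ne_zero fun h0 => hi ?_
    rw [sub_eq_zero, Real.sqrt_inj ENNReal.toReal_nonneg ENNReal.toReal_nonneg] at h0
    exact (ENNReal.toReal_eq_toReal_iff' (p.apply_ne_top i) (q.apply_ne_top i)).1 h0
  linarith

end FiniteLaws

/-! ### Transition matrices and their rows -/

section Rows

variable {S : Type*} [Fintype S] [DecidableEq S]

theorem rowPMF_apply (P : Matrix.rowStochastic ℝ S) (i j : S) :
    rowPMF P i j = ENNReal.ofReal ((P : Matrix S S ℝ) i j) := rfl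

theorem toReal_rowPMF (P : Matrix.rowStochastic ℝ S) (i j : S) :
    (rowPMF P i j).toReal = (P : Matrix S S ℝ) i j :=
  ENNReal.toReal_ofReal (Matrix.nonneg_of_mem_rowStochastic P.2)

theorem rowPMF_one (i : S) : rowPMF (1 : Matrix.rowStochastic ℝ S) i = PMF.pure i := by
  ext j
  rw [rowPMF_apply, PMF.pure_apply, OneMemClass.coe_one, Matrix.one_apply]
  by_cases h : i = j
  · simp [h]
  · simp [h, Ne.symm h]

theorem rowPMF_mul (P Q : Matrix.rowStochastic ℝ S) (i : S) :
    rowPMF (P * Q) i = (rowPMF P i).bind (rowPMF Q) := by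
  ext j
  rw [rowPMF_apply, PMF.bind_apply, tsum_fintype, Submonoid.coe_mul, Matrix.mul_apply,
    ENNReal.ofReal_sum_of_nonneg]
  · exact Finset.sum_congr rfl fun k _ =>
      ENNReal.ofReal_mul (Matrix.nonneg_of_mem_rowStochastic P.2)
  · exact fun k _ => mul_nonneg (Matrix.nonneg_of_mem_rowStochastic P.2)
      (Matrix.nonneg_of_mem_rowStochastic Q.2)

theorem bind_rowPMF_one (p : PMF S) : p.bind (rowPMF (1 : Matrix.rowStochastic ℝ S)) = p := by
  rw [funext rowPMF_one, PMF.bind_pure]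

theorem bind_rowPMF_mul (p : PMF S) (P Q : Matrix.rowStochastic ℝ S) :
    p.bind (rowPMF (P * Q)) = (p.bind (rowPMF P)).bind (rowPMF Q) := by
  rw [funext (rowPMF_mul P Q), PMF.bind_bind]

theorem bind_apply_eq_zero_congr (p p' : PMF S) (P Q : Matrix.rowStochastic ℝ S)
    (hp : ∀ i, p i = 0 ↔ p' i = 0)
    (hPQ : ∀ i j, 0 < (P : Matrix S S ℝ) i j ↔ 0 < (Q : Matrix S S ℝ) i j) (j : S) :
    p.bind (rowPMF P) j = 0 ↔ p'.bind (rowPMF Q) j = 0 := by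
  simp only [PMF.bind_apply, ENNReal.tsum_eq_zero, mul_eq_zero, hp, rowPMF_apply,
    ENNReal.ofReal_eq_zero, ← not_lt, hPQ]

/-- In an ergodic chain each state is reached from everywhere in exactly `n` steps, for every large
`n`. -/
theorem IsErgodic.eventually_pow_pos {P : Matrix S S ℝ} (hP : IsErgodic P) (j : S) :
    ∃ N : ℕ, ∀ n ≥ N, ∀ i, 0 < (P ^ n) i j := by
  have hnn := hP.1.nonneg
  have hpos := (Matrix.isIrreducible_iff_exists_pow_pos hnn).1 hP.1
  have hmul : ∀ {m n : ℕ} {i k l : S}, 0 < (P ^ m) i k → 0 < (P ^ n) k l →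
      0 < (P ^ (m + n)) i l := by
    intro m n i k l h₁ h₂
    rw [pow_add, Matrix.mul_apply]
    exact Finset.sum_pos' (fun x _ => mul_nonneg (Matrix.pow_apply_nonneg hnn m i x)
      (Matrix.pow_apply_nonneg hnn n x l)) ⟨k, Finset.mem_univ k, mul_pos h₁ h₂⟩
  -- Aperiodicity says that the return times have gcd `1`, so every large integer is a sum of return
  -- times, and positivity of the return probability is preserved by sums.
  set R : Set ℕ := {n | 0 < n ∧ 0 < (P ^ n) j j}
  have hgcd : Nat.setGcd R = 1 :=
    hP.2 j _ fun n hn hn' => Nat.setGcd_dvd_of_mem ⟨hn, hn'⟩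
  obtain ⟨N₀, hN₀⟩ := Nat.exists_mem_closure_of_ge R
  have hret : ∀ n ≥ N₀, 0 < (P ^ n) j j := by
    intro n hn
    refine AddSubmonoid.closure_induction (fun m hm => hm.2) (by simp)
      (fun a b _ _ ha hb => hmul ha hb) (hN₀ n hn (by simp [hgcd]))
  choose k _ hk using fun i => hpos i j
  -- The sum dominates every `k i`, so after travelling from `i` to `j` at least `N₀` steps remain
  -- for returning to `j`.
  refine ⟨N₀ + ∑ i, k i, fun n hn i => ?_⟩
  have hki : k i ≤ ∑ i, k i := Finset.single_le_sum (fun _ _ => Nat.zero_le _) (Finset.mem_univ i)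
  have := hmul (hk i) (hret (n - k i) (by omega))
  rwa [Nat.add_sub_cancel' (by omega)] at this

/-- Doeblin's condition: from any initial law, the state `j` has after `N` steps a probability which
is bounded below. -/
theorem exists_le_bind_pow {P : Matrix.rowStochastic ℝ S} {j : S} {N : ℕ}
    (hN : ∀ i, 0 < ((P : Matrix S S ℝ) ^ N) i j) :
    ∃ ε : ℝ, 0 < ε ∧ ∀ p : PMF S, ε ≤ (p.bind (rowPMF (P ^ N)) j).toReal := by
  obtain ⟨i₀, -, hi₀⟩ := Finset.exists_min_image Finset.univ
    (fun i => ((P : Matrix S S ℝ) ^ N) i j) ⟨j, Finset.mem_univ j⟩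
  refine ⟨_, hN i₀, fun p => ?_⟩
  rw [toReal_bind]
  calc ((P : Matrix S S ℝ) ^ N) i₀ j = ∑ i, (p i).toReal * ((P : Matrix S S ℝ) ^ N) i₀ j := by
        rw [← Finset.sum_mul, sum_toReal, one_mul]
    _ ≤ _ := Finset.sum_le_sum fun i _ => by
        rw [toReal_rowPMF, SubmonoidClass.coe_pow]
        exact mul_le_mul_of_nonneg_left (hi₀ i (Finset.mem_univ i)) ENNReal.toReal_nonneg

end Rows

/-! ### Sums against product laws -/

section ProductLaws

variable {ι S : Type*} [Fintype ι] [DecidableEq ι] [Fintype S]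

theorem sum_pi_mul_eval (p : ι → PMF S) (a₀ : ι) (f : S → ℝ≥0∞) :
    ∑ y : ι → S, (∏ a, p a (y a)) * f (y a₀) = ∑ s, p a₀ s * f s := by
  have h : ∀ y : ι → S, (∏ a, p a (y a)) * f (y a₀) =
      ∏ a, p a (y a) * (if a = a₀ then f (y a) else 1) := by
    intro y
    rw [Finset.prod_mul_distrib, Finset.prod_ite_eq' Finset.univ a₀]
    simp
  rw [Finset.sum_congr rfl fun y _ => h y,
    ← Fintype.prod_sum fun a s => p a s * if a = a₀ then f s else 1, Finset.prod_eq_single a₀]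
  · simp
  · intro a _ ha
    simp only [if_neg ha, mul_one]
    rw [← tsum_fintype (L := SummationFilter.unconditional S), (p a).tsum_coe]
  · simp

/-- Conditioning a product law on the coordinate `a₀` replaces that factor by a point mass and
leaves the others alone. This is why observing one arm preserves the independence of the arms. -/
theorem sum_pi_disintegrate (p : ι → PMF S) (a₀ : ι) (F : S → (ι → S) → ℝ≥0∞) :
    ∑ s, p a₀ s * ∑ x : ι → S, (∏ a, (if a = a₀ then PMF.pure s else p a) (x a)) * F s x =
      ∑ y : ι → S, (∏ a, p a (y a)) * F (y a₀) y := by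
  simp_rw [Finset.mul_sum]
  rw [Finset.sum_comm]
  refine Finset.sum_congr rfl fun y _ => ?_
  rw [Finset.sum_eq_single (y a₀)]
  · rw [← mul_assoc, ← Finset.mul_prod_erase _ _ (Finset.mem_univ a₀),
      ← Finset.mul_prod_erase Finset.univ (fun a => p a (y a)) (Finset.mem_univ a₀)]
    simp only [if_true, PMF.pure_apply, one_mul]
    congr 2
    refine Finset.prod_congr rfl fun a ha => ?_
    rw [if_neg (Finset.ne_of_mem_erase ha)]
  · intro s _ hs
    rw [← Finset.mul_prod_erase _ _ (Finset.mem_univ a₀)]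
    simp [PMF.pure_apply, hs.symm]
  · simp

theorem sum_pi_bind (p : ι → PMF S) (q : ι → S → PMF S) (y : ι → S) :
    ∑ x : ι → S, (∏ a, p a (x a)) * ∏ a, q a (x a) (y a) = ∏ a, (p a).bind (q a) (y a) := by
  simp_rw [← Finset.prod_mul_distrib, PMF.bind_apply, tsum_fintype]
  rw [← Fintype.prod_sum fun a s => p a s * q a s (y a)]

end ProductLaws

end OddArm

namespace OddArm

variable {K : ℕ} {S : Type*} [Fintype S] [DecidableEq S]

/-! ### The data used by the policy -/

section Congr

variable {o o' : ℕ → Obs K S} {n : ℕ}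

-- This and the congruences that follow express causality: what the policy computes from the records
-- up to time `n` ignores later records.
omit [Fintype S] [DecidableEq S] in
theorem delayState_congr (h : ∀ t ≤ n, o t = o' t) : ∀ t ≤ n + 1, delayState o t = delayState o' t
  | 0, _ => by simp only [delayState, h 0 (Nat.zero_le n)]
  | t + 1, ht => by
    simp only [delayState, h t (by omega), delayState_congr h t (by omega)]

namespace Model

theorem obsLik_congr (M : Model K S) (g : Fin K) (h : ∀ t ≤ n, o t = o' t) {t : ℕ} (ht : t ≤ n) :
    M.obsLik g o t = M.obsLik g o' t := by
  simp only [obsLik, h t ht, delayState_congr h t (by omega)]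

theorem statZ_congr (M : Model K S) (g g' : Fin K) (h : ∀ t ≤ n, o t = o' t) :
    M.statZ g g' o n = M.statZ g g' o' n := by
  refine Finset.sum_congr rfl fun t ht => ?_
  have ht' : t ≤ n := by simpa [Nat.lt_succ_iff] using ht
  rw [obsLik_congr M g h ht', obsLik_congr M g' h ht']

theorem mem_bestGuesses (M : Model K S) (o : ℕ → Obs K S) (n : ℕ) (g : Fin K) :
    g ∈ M.bestGuesses o n ↔ ∀ g', M.statM g' o n ≤ M.statM g o n := by
  simp [bestGuesses]

theorem bestGuesses_congr (M : Model K S) (h : ∀ t ≤ n, o t = o' t) :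
    M.bestGuesses o n = M.bestGuesses o' n := by
  ext g
  simp only [mem_bestGuesses, statM, statZ_congr M _ _ h]

theorem actionLaw_congr [NeZero K] (M : Model K S) (Λ : Fin K → SRS K S)
    (h : ∀ t ≤ n, o t = o' t) : M.actionLaw Λ n o = M.actionLaw Λ n o' := by
  simp only [actionLaw, bestGuesses_congr M h, delayState_congr h (n + 1) le_rfl]

end Model

end Congr

namespace Model

/-- Conditional law of the state of arm `a` at time `t` given the records at times `< t`, when arm
`g` is odd. -/
def predLaw (M : Model K S) (g : Fin K) (o : ℕ → Obs K S) : ℕ → Fin K → PMF S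
  | 0, a => M.init a
  | t + 1, a =>
    (if a = (o t).2.1 then PMF.pure (o t).2.2 else predLaw M g o t a).bind (rowPMF (M.arm g a))

/-- Conditional law of the state of arm `a` at time `t` given the records at times `≤ t`, when arm
`g` is odd. -/
def postLaw (M : Model K S) (g : Fin K) (o : ℕ → Obs K S) (t : ℕ) (a : Fin K) : PMF S :=
  if a = (o t).2.1 then PMF.pure (o t).2.2 else M.predLaw g o t a

theorem predLaw_succ (M : Model K S) (g : Fin K) (o : ℕ → Obs K S) (t : ℕ) (a : Fin K) :
    M.predLaw g o (t + 1) a = (M.postLaw g o t a).bind (rowPMF (M.arm g a)) := rfl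

theorem predLaw_congr (M : Model K S) (g : Fin K) {o o' : ℕ → Obs K S} :
    ∀ {t : ℕ}, (∀ i < t, o i = o' i) → M.predLaw g o t = M.predLaw g o' t
  | 0, _ => rfl
  | t + 1, h => by
    ext1 a
    rw [predLaw, predLaw, predLaw_congr M g fun i hi => h i (by omega), h t (by omega)]

theorem postLaw_update (M : Model K S) (g : Fin K) (o : ℕ → Obs K S) (t : ℕ) (r : Obs K S) :
    M.postLaw g (Function.update o t r) t =
      fun a => if a = r.2.1 then PMF.pure r.2.2 else M.predLaw g o t a := by
  ext1 a
  rw [postLaw, Function.update_self, predLaw_congr M g (o' := o)]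
  intro i hi
  rw [Function.update_of_ne hi.ne]

end Model

/-! ### One step of the trajectory -/

variable [MeasurableSpace S] [MeasurableSingletonClass S]

theorem extend_frestrictLe {X : Type*} (ω : ℕ → X) {n t : ℕ} (ht : t ≤ n) :
    extend (Preorder.frestrictLe n ω) t = ω t := by
  simp [extend, ht]

/-- Such a function factors through the finite history, which lives in a countable discrete space.
-/
theorem measurable_of_dependsOn {X Y : Type*} [MeasurableSpace X] [MeasurableSpace Y]
    [DiscreteMeasurableSpace X] [Countable X] {F : (ℕ → X) → Y} {n : ℕ}
    (hF : DependsOn F (Set.Iic n)) : Measurable F := by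
  have h : F = (fun x : Finset.Iic n → X => F (extend x)) ∘ Preorder.frestrictLe n := by
    ext1 ω
    exact hF fun t ht => (extend_frestrictLe ω ht).symm
  rw [h]
  exact (Measurable.of_discrete).comp (by fun_prop)

omit [DecidableEq S] in
theorem lintegral_toMeasure_prod_toMeasure (p : Fin K → PMF S) {U : Type*} [Fintype U]
    [MeasurableSpace U] [MeasurableSingletonClass U] (q : PMF U) (f : (Fin K → S) × U → ℝ≥0∞) :
    ∫⁻ c, f c ∂(Measure.pi fun a => (p a).toMeasure).prod q.toMeasure =
      ∑ u, q u * ∑ y : Fin K → S, (∏ a, p a (y a)) * f (y, u) := by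
  rw [lintegral_fintype, Fintype.sum_prod_type_right]
  refine Finset.sum_congr rfl fun u _ => ?_
  rw [Finset.mul_sum]
  refine Finset.sum_congr rfl fun y _ => ?_
  rw [← Set.singleton_prod_singleton, Measure.prod_prod, Measure.pi_singleton]
  simp only [PMF.toMeasure_apply_singleton _ _ (measurableSet_singleton _)]
  ring

namespace Model

variable [NeZero K]

theorem lintegral_law_zero (M : Model K S) (Λ : Fin K → SRS K S) (g : Fin K)
    (F : Config K S → ℝ≥0∞) :
    ∫⁻ ω, F (ω 0) ∂M.law Λ g =
      ∑ y : Fin K → S, (∏ a, M.init a (y a)) * F (y, (0, 0, 0)) := by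
  have hmap : (M.law Λ g).map (fun ω => ω 0) = M.startLaw := by
    have h : (fun ω : ℕ → Config K S => ω 0) =
        (MeasurableEquiv.piUnique (fun _ : Finset.Iic 0 => Config K S)) ∘
          Preorder.frestrictLe 0 := rfl
    rw [h, ← Measure.map_map (by fun_prop) (by fun_prop), law, Kernel.trajMeasure,
      Measure.map_comp _ _ (by fun_prop), Kernel.traj_map_frestrictLe_of_le le_rfl,
      Measure.deterministic_comp_eq_map, Measure.map_map (by fun_prop) (by fun_prop),
      Measure.map_map (by fun_prop) (by fun_prop)]
    exact Measure.map_id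
  rw [← lintegral_map (f := F) (μ := M.law Λ g) Measurable.of_discrete (measurable_pi_apply 0),
    hmap, startLaw, lintegral_toMeasure_prod_toMeasure, Finset.sum_eq_single (0, 0, 0)]
  · simp
  · intro u _ hu
    rw [PMF.pure_apply_of_ne _ _ hu, zero_mul]
  · simp

/-- The one-step Markov property in integrated form: the coordinate at time `n + 1` is resampled
from the step kernel. -/
theorem lintegral_law_succ (M : Model K S) (Λ : Fin K → SRS K S) (g : Fin K) {n : ℕ}
    {F : (ℕ → Config K S) → ℝ≥0∞} (hF : DependsOn F (Set.Iic (n + 1))) :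
    ∫⁻ ω, F ω ∂M.law Λ g =
      ∫⁻ ω, ∑ u, M.actionLaw Λ n (records ω) u *
        ∑ y : Fin K → S, (∏ a, rowPMF (M.arm g a) ((ω n).1 a) (y a)) *
          F (Function.update ω (n + 1) (y, u)) ∂M.law Λ g := by
  set G : (Finset.Iic n → Config K S) × Config K S → ℝ≥0∞ :=
    fun p => F (Function.update (extend p.1) (n + 1) p.2)
  have hG : Measurable G := Measurable.of_discrete
  have hFG : ∀ ω, F ω = G (Preorder.frestrictLe n ω, ω (n + 1)) := by
    refine fun ω => hF fun t ht => ?_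
    rcases eq_or_ne t (n + 1) with rfl | hne
    · simp
    · rw [Function.update_of_ne hne, extend_frestrictLe]
      exact Nat.le_of_lt_succ (lt_of_le_of_ne ht hne)
  have hmeas : Measurable fun ω : ℕ → Config K S => (Preorder.frestrictLe n ω, ω (n + 1)) := by
    fun_prop
  have hstep := Kernel.map_frestrictLe_trajMeasure_compProd_eq_map_trajMeasure
    (X := fun _ => Config K S) (μ₀ := M.startLaw) (κ := M.stepKernel Λ g) (a := n)
  rw [lintegral_congr hFG, ← lintegral_map (f := G) (μ := M.law Λ g) hG hmeas]
  refine (congrArg (fun μ => ∫⁻ p, G p ∂μ) hstep).symm.trans ?_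
  rw [Measure.lintegral_compProd hG, lintegral_map Measurable.of_discrete (by fun_prop)]
  refine lintegral_congr fun ω => ?_
  have hact : M.actionLaw Λ n (records (extend (Preorder.frestrictLe n ω))) =
      M.actionLaw Λ n (records ω) :=
    actionLaw_congr M Λ fun t ht => by rw [records, records, extend_frestrictLe ω ht]
  have hk : M.stepKernel Λ g n (Preorder.frestrictLe n ω) =
      (Measure.pi fun a => (rowPMF (M.arm g a) ((ω n).1 a)).toMeasure).prod
        (M.actionLaw Λ n (records ω)).toMeasure := by
    rw [← hact, ← extend_frestrictLe ω le_rfl]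
    rfl
  rw [hk, lintegral_toMeasure_prod_toMeasure]
  refine Finset.sum_congr rfl fun u _ => congrArg _ (Finset.sum_congr rfl fun y _ => ?_)
  congr 1
  refine hF fun t ht => ?_
  rcases eq_or_ne t (n + 1) with rfl | hne
  · simp
  · rw [Function.update_of_ne hne, Function.update_of_ne hne, extend_frestrictLe]
    exact Nat.le_of_lt_succ (lt_of_le_of_ne ht hne)

end Model

end OddArm

namespace OddArm

variable {K : ℕ} {S : Type*} [Fintype S] [DecidableEq S]

/-! ### Filtering: the law of the hidden states given the records -/

omit [Fintype S] [DecidableEq S] in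
theorem records_update (ω : ℕ → Config K S) (n : ℕ) (c : Config K S) :
    records (Function.update ω n c) = Function.update (records ω) n (Config.obs c) := by
  ext1 t
  rcases eq_or_ne t n with rfl | h
  · simp [records]
  · simp [records, h]

omit [Fintype S] [DecidableEq S] in
theorem dependsOn_comp_records {Y : Type*} {f : (ℕ → Obs K S) → Y} {s : Set ℕ}
    (hf : DependsOn f s) : DependsOn (fun ω : ℕ → Config K S => f (records ω)) s :=
  fun ω ω' h => hf fun t ht => by rw [records, records, h t ht]

theorem update_congr {X : Type*} {o o' : ℕ → X} {n : ℕ} (h : ∀ t ∈ Set.Iic n, o t = o' t) (r : X) :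
    ∀ t ∈ Set.Iic (n + 1), Function.update o (n + 1) r t = Function.update o' (n + 1) r t := by
  intro t ht
  rcases eq_or_ne t (n + 1) with rfl | hne
  · simp
  · rw [Function.update_of_ne hne, Function.update_of_ne hne]
    exact h t (Nat.le_of_lt_succ (lt_of_le_of_ne ht hne))

variable [MeasurableSpace S] [MeasurableSingletonClass S]

namespace Model

variable [NeZero K] (M : Model K S) (Λ : Fin K → SRS K S) (g : Fin K)

/-- The prediction half of the filter recursion. The filter at time `n` enters as a hypothesis, so
that the induction in `lintegral_law_filter` can supply it. -/
theorem lintegral_law_predict_of_filter {n : ℕ}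
    (H : ∀ f : (ℕ → Obs K S) → (Fin K → S) → ℝ≥0∞,
      (∀ x, DependsOn (fun o => f o x) (Set.Iic n)) →
      ∫⁻ ω, f (records ω) (ω n).1 ∂M.law Λ g =
        ∫⁻ ω, ∑ x : Fin K → S, (∏ a, M.postLaw g (records ω) n a (x a)) * f (records ω) x
          ∂M.law Λ g)
    (f : (ℕ → Obs K S) → (Fin K → S) → ℝ≥0∞)
    (hf : ∀ x, DependsOn (fun o => f o x) (Set.Iic (n + 1))) :
    ∫⁻ ω, f (records ω) (ω (n + 1)).1 ∂M.law Λ g =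
      ∫⁻ ω, ∑ u, M.actionLaw Λ n (records ω) u *
        ∑ y : Fin K → S, (∏ a, M.predLaw g (records ω) (n + 1) a (y a)) *
          f (Function.update (records ω) (n + 1) (u.2.1, u.2.2, y u.2.2)) y ∂M.law Λ g := by
  rw [lintegral_law_succ M Λ g (n := n)]
  · simp only [records_update, Function.update_self, Config.obs]
    rw [H fun o x => ∑ u, M.actionLaw Λ n o u *
        ∑ y : Fin K → S, (∏ a, rowPMF (M.arm g a) (x a) (y a)) *
          f (Function.update o (n + 1) (u.2.1, u.2.2, y u.2.2)) y]
    · refine lintegral_congr fun ω => ?_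
      simp_rw [Finset.mul_sum]
      rw [Finset.sum_comm]
      refine Finset.sum_congr rfl fun u _ => ?_
      rw [Finset.sum_comm]
      refine Finset.sum_congr rfl fun y _ => ?_
      simp_rw [predLaw_succ]
      rw [← sum_pi_bind, Finset.sum_mul, Finset.mul_sum]
      exact Finset.sum_congr rfl fun x _ => by ring
    · intro x o o' h
      dsimp only
      rw [actionLaw_congr M Λ h]
      exact Finset.sum_congr rfl fun u _ => congrArg _ (Finset.sum_congr rfl fun y _ =>
        congrArg _ (hf y (update_congr h _)))
  · intro ω ω' h
    dsimp only
    rw [h (n + 1) (Set.mem_Iic.2 le_rfl)]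
    exact dependsOn_comp_records (hf (ω' (n + 1)).1) h

theorem lintegral_law_filter : ∀ (n : ℕ) (f : (ℕ → Obs K S) → (Fin K → S) → ℝ≥0∞),
    (∀ x, DependsOn (fun o => f o x) (Set.Iic n)) →
    ∫⁻ ω, f (records ω) (ω n).1 ∂M.law Λ g =
      ∫⁻ ω, ∑ x : Fin K → S, (∏ a, M.postLaw g (records ω) n a (x a)) * f (records ω) x
        ∂M.law Λ g
  | 0, f, hf => by
    have hrec : ∀ ω : ℕ → Config K S, ∀ x,
        f (records ω) x = f (fun _ => Config.obs (ω 0)) x := fun ω x =>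
      hf x fun t ht => by rw [records, Nat.le_zero.1 ht]
    have hpost : ∀ (ω : ℕ → Config K S) a, M.postLaw g (records ω) 0 a =
        if a = (Config.obs (ω 0)).2.1 then PMF.pure (Config.obs (ω 0)).2.2 else M.init a :=
      fun _ _ => rfl
    simp only [hrec, hpost]
    rw [lintegral_law_zero M Λ g fun c => f (fun _ => Config.obs c) c.1,
      lintegral_law_zero M Λ g fun c => ∑ x : Fin K → S,
        (∏ a, (if a = (Config.obs c).2.1 then PMF.pure (Config.obs c).2.2 else M.init a) (x a)) *
          f (fun _ => Config.obs c) x]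
    simp only [Config.obs]
    refine (sum_pi_disintegrate M.init 0 fun s x => f (fun _ => (0, 0, s)) x).symm.trans
      (Eq.symm ?_)
    exact sum_pi_mul_eval M.init 0 fun s => ∑ x : Fin K → S,
      (∏ a, (if a = 0 then PMF.pure s else M.init a) (x a)) * f (fun _ => (0, 0, s)) x
  | n + 1, f, hf => by
    have H := lintegral_law_predict_of_filter M Λ g (lintegral_law_filter n)
    -- Both sides are predicted from time `n`. They agree because, for a fixed action, averaging
    -- over the posterior after seeing the pulled arm recovers the predictive product law.
    rw [H f hf, H fun o _ => ∑ x : Fin K → S, (∏ a, M.postLaw g o (n + 1) a (x a)) * f o x]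
    · refine lintegral_congr fun ω => Finset.sum_congr rfl fun u _ => congrArg _ ?_
      simp only [postLaw_update]
      rw [← sum_pi_disintegrate _ u.2.2 fun s y =>
          f (Function.update (records ω) (n + 1) (u.2.1, u.2.2, s)) y,
        sum_pi_mul_eval _ u.2.2 fun s => ∑ x : Fin K → S,
          (∏ a, (if a = u.2.2 then PMF.pure s else M.predLaw g (records ω) (n + 1) a) (x a)) *
            f (Function.update (records ω) (n + 1) (u.2.1, u.2.2, s)) x]
    · intro _ o o' h
      refine Finset.sum_congr rfl fun x _ => ?_
      rw [show f o x = f o' x from hf x h]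
      have hpost : M.postLaw g o (n + 1) = M.postLaw g o' (n + 1) := by
        ext1 a
        rw [postLaw, postLaw, h (n + 1) (Set.mem_Iic.2 le_rfl),
          predLaw_congr M g fun i hi => h i (Set.mem_Iic.2 hi.le)]
      rw [hpost]

/-- One-step transition of the process of records. -/
theorem lintegral_records_succ {n : ℕ} {f : (ℕ → Obs K S) → ℝ≥0∞}
    (hf : DependsOn f (Set.Iic (n + 1))) :
    ∫⁻ ω, f (records ω) ∂M.law Λ g =
      ∫⁻ ω, ∑ u, M.actionLaw Λ n (records ω) u *
        ∑ s, M.predLaw g (records ω) (n + 1) u.2.2 s *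
          f (Function.update (records ω) (n + 1) (u.2.1, u.2.2, s)) ∂M.law Λ g := by
  rw [lintegral_law_predict_of_filter M Λ g (lintegral_law_filter M Λ g n) (fun o _ => f o)
    fun _ => hf]
  refine lintegral_congr fun ω => Finset.sum_congr rfl fun u _ => congrArg _ ?_
  exact sum_pi_mul_eval _ u.2.2 fun s => f (Function.update (records ω) (n + 1) (u.2.1, u.2.2, s))

theorem lintegral_records_zero {f : (ℕ → Obs K S) → ℝ≥0∞} (hf : DependsOn f (Set.Iic 0)) :
    ∫⁻ ω, f (records ω) ∂M.law Λ g = ∑ s, M.init 0 s * f fun _ => (0, 0, s) := by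
  have hrec : ∀ ω : ℕ → Config K S, f (records ω) = f fun _ => Config.obs (ω 0) := fun ω =>
    hf fun t ht => by rw [records, Nat.le_zero.1 ht]
  simp only [hrec]
  rw [lintegral_law_zero M Λ g fun c => f fun _ => Config.obs c]
  exact sum_pi_mul_eval M.init 0 fun s => f fun _ => (0, 0, s)

/-! ### The likelihood of the records -/

/-- Conditional probability, given the records at times `< t`, of intending and pulling the given
arms at time `t`. -/
def actLik (o : ℕ → Obs K S) : ℕ → Fin K × Fin K → ℝ≥0∞
  | 0, u => if u = (0, 0) then 1 else 0
  | t + 1, u => ∑ θ, M.actionLaw Λ t o (θ, u)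

/-- Conditional probability, given the records at times `< t`, of the record at time `t`. -/
def recLik (o : ℕ → Obs K S) (t : ℕ) : ℝ≥0∞ :=
  M.actLik Λ o t ((o t).1, (o t).2.1) * M.predLaw g o t (o t).2.1 (o t).2.2

omit [MeasurableSpace S] [MeasurableSingletonClass S] in
theorem actLik_congr {o o' : ℕ → Obs K S} {t : ℕ} (h : ∀ i < t, o i = o' i) :
    M.actLik Λ o t = M.actLik Λ o' t := by
  cases t with
  | zero => rfl
  | succ t =>
    ext1 u
    rw [actLik, actLik, actionLaw_congr M Λ fun i hi => h i (Nat.lt_succ_of_le hi)]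

omit [MeasurableSpace S] [MeasurableSingletonClass S] in
theorem recLik_congr {o o' : ℕ → Obs K S} {t : ℕ} (h : ∀ i ≤ t, o i = o' i) :
    M.recLik Λ g o t = M.recLik Λ g o' t := by
  rw [recLik, recLik, actLik_congr M Λ fun i hi => h i hi.le,
    predLaw_congr M g fun i hi => h i hi.le, h t le_rfl]

/-- The guess `θ` is not part of a record, so it is summed out, leaving a sum over the next record
weighted by its conditional likelihood. -/
theorem lintegral_records_succ' {n : ℕ} {f : (ℕ → Obs K S) → ℝ≥0∞}
    (hf : DependsOn f (Set.Iic (n + 1))) :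
    ∫⁻ ω, f (records ω) ∂M.law Λ g =
      ∫⁻ ω, ∑ r : Obs K S, M.recLik Λ g (Function.update (records ω) (n + 1) r) (n + 1) *
        f (Function.update (records ω) (n + 1) r) ∂M.law Λ g := by
  rw [lintegral_records_succ M Λ g hf]
  refine lintegral_congr fun ω => ?_
  have hlt : ∀ r : Obs K S, ∀ i < n + 1, Function.update (records ω) (n + 1) r i = records ω i :=
    fun r i hi => Function.update_of_ne hi.ne _ _
  simp only [recLik, Function.update_self, actLik_congr M Λ (hlt _), predLaw_congr M g (hlt _)]
  simp only [actLik, Fintype.sum_prod_type, Finset.sum_mul, Finset.mul_sum, mul_assoc]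
  rw [Finset.sum_comm]
  refine Finset.sum_congr rfl fun b _ => ?_
  rw [Finset.sum_comm]
  refine Finset.sum_congr rfl fun a _ => ?_
  rw [Finset.sum_comm]

theorem lintegral_records_zero' {f : (ℕ → Obs K S) → ℝ≥0∞} (hf : DependsOn f (Set.Iic 0)) :
    ∫⁻ ω, f (records ω) ∂M.law Λ g =
      ∑ r : Obs K S, M.recLik Λ g (fun _ => r) 0 * f fun _ => r := by
  rw [lintegral_records_zero M Λ g hf]
  simp only [recLik, actLik, predLaw, Fintype.sum_prod_type, Prod.mk.injEq, ite_and, ite_mul,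
    one_mul, zero_mul]
  symm
  rw [Finset.sum_eq_single (0 : Fin K), Finset.sum_eq_single (0 : Fin K)]
  · simp
  · intro a _ ha
    simp [ha]
  · simp
  · intro b _ hb
    simp [hb]
  · simp

theorem law_cylinder (o : ℕ → Obs K S) : ∀ n : ℕ,
    M.law Λ g {ω | ∀ t ≤ n, records ω t = o t} = ∏ t ∈ Finset.range (n + 1), M.recLik Λ g o t := by
  classical
  intro n
  have hdep : ∀ n, DependsOn (fun o' : ℕ → Obs K S => if ∀ t ≤ n, o' t = o t then (1 : ℝ≥0∞) else 0)
      (Set.Iic n) := fun n o₁ o₂ h => by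
    have : (∀ t ≤ n, o₁ t = o t) ↔ ∀ t ≤ n, o₂ t = o t :=
      forall₂_congr fun t ht => by rw [h t ht]
    simp only [this]
  have hset : ∀ n, M.law Λ g {ω | ∀ t ≤ n, records ω t = o t} =
      ∫⁻ ω, (if ∀ t ≤ n, records ω t = o t then 1 else 0) ∂M.law Λ g := by
    intro n
    have hdep' : DependsOn (fun ω : ℕ → Config K S => ∀ t ≤ n, records ω t = o t) (Set.Iic n) :=
      fun ω ω' h => propext (forall₂_congr fun t ht => by rw [records, records, h t ht])
    rw [← lintegral_indicator_one]
    · simp only [Set.indicator_apply, Set.mem_ofPred_eq, Pi.one_apply]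
    · exact measurableSet_setOfPred.2 (measurable_of_dependsOn hdep')
  induction n with
  | zero =>
    rw [hset, lintegral_records_zero' M Λ g (hdep 0), Finset.sum_eq_single (o 0)]
    · simp only [Nat.le_zero, forall_eq, if_true, mul_one, zero_add, Finset.prod_range_one]
      exact recLik_congr M Λ g fun i hi => by rw [Nat.le_zero.1 hi]
    · intro r _ hr
      simp [hr]
    · simp
  | succ n ih =>
    rw [Finset.prod_range_succ, ← ih, hset, lintegral_records_succ' M Λ g (hdep (n + 1)), hset,
      ← lintegral_mul_const _ (Measurable.ite (measurableSet_setOfPred.2 (measurable_of_dependsOn (n := n)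
        fun ω ω' h => propext (forall₂_congr fun t ht => by rw [records, records, h t ht])))
        measurable_const measurable_const)]
    refine lintegral_congr fun ω => ?_
    rw [Finset.sum_eq_single (o (n + 1))]
    · by_cases hω : ∀ t ≤ n, records ω t = o t
      · have hall : ∀ t ≤ n + 1, Function.update (records ω) (n + 1) (o (n + 1)) t = o t := by
          intro t ht
          rcases eq_or_ne t (n + 1) with rfl | hne
          · simp
          · rw [Function.update_of_ne hne, hω t (by omega)]
        rw [if_pos hall, if_pos hω, mul_one, one_mul]
        exact recLik_congr M Λ g hall
      · have : ¬ ∀ t ≤ n + 1, Function.update (records ω) (n + 1) (o (n + 1)) t = o t := by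
          intro h
          refine hω fun t ht => ?_
          rw [← h t (by omega), Function.update_of_ne (by omega)]
        rw [if_neg this, if_neg hω, mul_zero, zero_mul]
    · intro r _ hr
      rw [if_neg, mul_zero]
      intro h
      exact hr (by simpa using h (n + 1) le_rfl)
    · simp

theorem ae_recLik_ne_zero (n : ℕ) : ∀ᵐ ω ∂M.law Λ g, M.recLik Λ g (records ω) n ≠ 0 := by
  classical
  have hdep : DependsOn (fun o : ℕ → Obs K S => if M.recLik Λ g o n = 0 then (1 : ℝ≥0∞) else 0)
      (Set.Iic n) := fun o o' h => by simp only [recLik_congr M Λ g h]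
  -- A record of conditional likelihood zero is weighted by that likelihood, so the expected
  -- indicator of the bad event vanishes.
  have hmul : ∀ x : ℝ≥0∞, x * (if x = 0 then 1 else 0) = 0 := fun x => by
    split_ifs with h <;> simp [h]
  have hzero : ∫⁻ ω, (if M.recLik Λ g (records ω) n = 0 then 1 else 0) ∂M.law Λ g = 0 := by
    cases n with
    | zero =>
      rw [lintegral_records_zero' M Λ g hdep]
      simp only [hmul, Finset.sum_const_zero]
    | succ n =>
      rw [lintegral_records_succ' M Λ g hdep]
      simp only [hmul, Finset.sum_const_zero, lintegral_zero]
  rw [lintegral_eq_zero_iff (measurable_of_dependsOn (dependsOn_comp_records hdep))] at hzero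
  filter_upwards [hzero] with ω hω h0
  simp [h0] at hω

end Model

end OddArm

namespace OddArm

variable {K : ℕ} {S : Type*} [Fintype S] [DecidableEq S]

/-! ### The statistics in terms of the conditional laws -/

namespace Model

theorem arm_support (M : Model K S)
    (hsupp : ∀ i j : S, 0 < (M.P₁ : Matrix S S ℝ) i j ↔ 0 < (M.P₂ : Matrix S S ℝ) i j)
    (g g' a : Fin K) (i j : S) :
    0 < (M.arm g a : Matrix S S ℝ) i j ↔ 0 < (M.arm g' a : Matrix S S ℝ) i j := by
  unfold arm
  split_ifs
  · rfl
  · exact hsupp i j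
  · exact (hsupp i j).symm
  · rfl

theorem predLaw_eq_zero_iff (M : Model K S)
    (hsupp : ∀ i j : S, 0 < (M.P₁ : Matrix S S ℝ) i j ↔ 0 < (M.P₂ : Matrix S S ℝ) i j)
    (g g' : Fin K) (o : ℕ → Obs K S) : ∀ (t : ℕ) (a : Fin K) (s : S),
    M.predLaw g o t a s = 0 ↔ M.predLaw g' o t a s = 0
  | 0, _, _ => Iff.rfl
  | t + 1, a, s => by
    refine bind_apply_eq_zero_congr _ _ _ _ (fun i => ?_) (M.arm_support hsupp g g' a) s
    split_ifs
    · rfl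
    · exact predLaw_eq_zero_iff M hsupp g g' o t a i

/-- The arms pulled at the times `t < K` are those of the initial sweep. -/
def IsSweep (o : ℕ → Obs K S) : Prop := ∀ t, ∀ ht : t < K, (o t).2.1 = ⟨t, ht⟩

/-- Arm `a` is first seen at time `a`. Until then it keeps its unconditional law; afterwards each
step without a pull adds one to the delay and one matrix factor, and a pull resets both. The two
cases are proved by one induction. -/
theorem predLaw_of_isSweep (M : Model K S) (g : Fin K) {o : ℕ → Obs K S} (ho : IsSweep o) :
    ∀ (t : ℕ) (a : Fin K),
      (t ≤ a → M.predLaw g o t a = (M.init a).bind (rowPMF (M.arm g a ^ t))) ∧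
      (a < t → M.predLaw g o t a =
        rowPMF (M.arm g a ^ (delayState o t).1 a) ((delayState o t).2 a))
  | 0, a => by simp [predLaw, bind_rowPMF_one]
  | t + 1, a => by
    obtain ⟨h₁, h₂⟩ := predLaw_of_isSweep M g ho t a
    have hA : (a : ℕ) = t → a = (o t).2.1 := by
      rintro rfl
      rw [ho a a.2]
    have hA' : a = (o t).2.1 → t < K → (a : ℕ) = t := by
      intro h ht
      rw [h, ho t ht]
    simp only [predLaw, delayState, updateState]
    by_cases ha : a = (o t).2.1
    · refine ⟨fun hta => ?_, fun _ => ?_⟩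
      · have := hA' ha (by omega)
        omega
      · simp only [if_pos ha, PMF.pure_bind, pow_one]
    · simp only [if_neg ha]
      refine ⟨fun hta => ?_, fun hta => ?_⟩
      · rw [h₁ (by omega), pow_succ, bind_rowPMF_mul]
      · have hne : (a : ℕ) ≠ t := fun h => ha (hA h)
        rw [h₂ (by omega), pow_succ, rowPMF_mul]

theorem obsLik_of_isSweep (M : Model K S) (g : Fin K) {o : ℕ → Obs K S} (ho : IsSweep o) (t : ℕ) :
    M.obsLik g o t = (M.predLaw g o t (o t).2.1 (o t).2.2).toReal := by
  obtain ⟨h₁, h₂⟩ := predLaw_of_isSweep M g ho t (o t).2.1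
  unfold obsLik
  split_ifs with ht
  · rw [h₁ (by rw [ho t ht]), toReal_bind, armMarginal]
    exact Finset.sum_congr rfl fun i _ => by rw [toReal_rowPMF, armPow, SubmonoidClass.coe_pow]
  · rw [h₂ (by omega), toReal_rowPMF, armPow, SubmonoidClass.coe_pow]

variable [NeZero K]

theorem actLik_ne_top (M : Model K S) (Λ : Fin K → SRS K S) (o : ℕ → Obs K S) (t : ℕ)
    (u : Fin K × Fin K) : M.actLik Λ o t u ≠ ∞ := by
  cases t with
  | zero =>
    rw [actLik]
    split_ifs <;> simp
  | succ t => exact ENNReal.sum_ne_top.2 fun _ _ => PMF.apply_ne_top _ _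

theorem isSweep_of_recLik_ne_zero (M : Model K S) (Λ : Fin K → SRS K S) (g : Fin K)
    {o : ℕ → Obs K S} (ho : ∀ t, M.recLik Λ g o t ≠ 0) : IsSweep o := by
  intro t ht
  have h : M.actLik Λ o t ((o t).1, (o t).2.1) ≠ 0 := left_ne_zero_of_mul (ho t)
  cases t with
  | zero =>
    simp only [actLik, ne_eq, ite_eq_right_iff, one_ne_zero, imp_false, not_not,
      Prod.mk.injEq] at h
    exact h.2
  | succ t =>
    simp only [actLik, actionLaw, dif_pos ht] at h
    obtain ⟨θ, -, hθ⟩ := Finset.exists_ne_zero_of_sum_ne_zero h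
    rw [← PMF.mem_support_iff, PMF.mem_support_pure_iff] at hθ
    exact congrArg (fun u => u.2.2) hθ

variable [MeasurableSpace S] [MeasurableSingletonClass S]

theorem ae_recLik (M : Model K S) (Λ : Fin K → SRS K S) (h : Fin K) :
    ∀ᵐ ω ∂M.law Λ h, ∀ t, M.recLik Λ h (records ω) t ≠ 0 :=
  ae_all_iff.2 fun t => M.ae_recLik_ne_zero Λ h t

omit [NeZero K] [MeasurableSpace S] [MeasurableSingletonClass S] in
theorem statZ_eq_of_isSweep (M : Model K S) (g g' : Fin K) {o : ℕ → Obs K S} (ho : IsSweep o)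
    (n : ℕ) : M.statZ g g' o n = ∑ t ∈ Finset.range (n + 1),
      Real.log ((M.predLaw g o t (o t).2.1 (o t).2.2).toReal /
        (M.predLaw g' o t (o t).2.1 (o t).2.2).toReal) :=
  Finset.sum_congr rfl fun t _ => by
    rw [obsLik_of_isSweep M g ho, obsLik_of_isSweep M g' ho]

omit [MeasurableSpace S] [MeasurableSingletonClass S] in
theorem predLaw_toReal_ne_zero (M : Model K S) (Λ : Fin K → SRS K S)
    (hsupp : ∀ i j : S, 0 < (M.P₁ : Matrix S S ℝ) i j ↔ 0 < (M.P₂ : Matrix S S ℝ) i j)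
    {h : Fin K} {o : ℕ → Obs K S} {t : ℕ} (ho : M.recLik Λ h o t ≠ 0) (g : Fin K) :
    (M.predLaw g o t (o t).2.1 (o t).2.2).toReal ≠ 0 := by
  have h₁ : M.predLaw h o t (o t).2.1 (o t).2.2 ≠ 0 := right_ne_zero_of_mul ho
  exact ENNReal.toReal_ne_zero.2
    ⟨fun h0 => h₁ ((M.predLaw_eq_zero_iff hsupp h g o t _ _).2 h0), PMF.apply_ne_top _ _⟩

/-- On trajectories of positive likelihood the log-likelihood ratio is the test statistic. -/
theorem logLikRatio_eq_statZ (M : Model K S) (Λ : Fin K → SRS K S)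
    (hsupp : ∀ i j : S, 0 < (M.P₁ : Matrix S S ℝ) i j ↔ 0 < (M.P₂ : Matrix S S ℝ) i j)
    {h : Fin K} {ω : ℕ → Config K S} (hω : ∀ t, M.recLik Λ h (records ω) t ≠ 0)
    (g g' : Fin K) (n : ℕ) :
    M.logLikRatio Λ g g' n ω = M.statZ g g' (records ω) n := by
  have hact (t : ℕ) :
      (M.actLik Λ (records ω) t ((records ω t).1, (records ω t).2.1)).toReal ≠ 0 :=
    ENNReal.toReal_ne_zero.2 ⟨left_ne_zero_of_mul (hω t), M.actLik_ne_top Λ _ t _⟩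
  rw [statZ_eq_of_isSweep M g g' (isSweep_of_recLik_ne_zero M Λ h hω), logLikRatio, measureReal_def,
    measureReal_def, law_cylinder, law_cylinder, ENNReal.toReal_prod, ENNReal.toReal_prod,
    ← Finset.prod_div_distrib, Real.log_prod]
  · refine Finset.sum_congr rfl fun t _ => ?_
    simp only [recLik, ENNReal.toReal_mul]
    -- The action likelihood does not depend on the odd arm and cancels.
    rw [mul_div_mul_left _ _ (hact t)]
  · intro t _
    simp only [recLik, ENNReal.toReal_mul]
    exact div_ne_zero (mul_ne_zero (hact t) (M.predLaw_toReal_ne_zero Λ hsupp (hω t) g))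
      (mul_ne_zero (hact t) (M.predLaw_toReal_ne_zero Λ hsupp (hω t) g'))

end Model

end OddArm

namespace OddArm

variable {K : ℕ} {S : Type*} [Fintype S] [DecidableEq S]

/-! ### Exponential decay of the expected square root of the likelihood ratio -/

/-- Used with pairs (intended arm, pulled arm): a gain `e` on the event that `b` is pulled costs
only the probability `c` of that event. -/
theorem sum_mul_le_one_sub {α β : Type*} [Fintype α] [Fintype β] [DecidableEq β]
    {w G : α × β → ℝ} (hw : ∀ u, 0 ≤ w u) (hw₁ : ∑ u, w u = 1) (hG : ∀ u, G u ≤ 1) {b : β}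
    {c e : ℝ} (he : 0 ≤ e) (hGb : ∀ a, G (a, b) ≤ 1 - e) (hc : c ≤ ∑ a, w (a, b)) :
    ∑ u, w u * G u ≤ 1 - c * e := by
  calc ∑ u, w u * G u ≤ ∑ u, (w u - if u.2 = b then w u * e else 0) := by
        refine Finset.sum_le_sum fun u _ => ?_
        split_ifs with hu
        · have : G u ≤ 1 - e := by
            have := hGb u.1
            rwa [← hu] at this
          nlinarith [hw u]
        · nlinarith [hw u, hG u]
    _ = 1 - (∑ a, w (a, b)) * e := by
        rw [Finset.sum_sub_distrib, hw₁, Fintype.sum_prod_type]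
        simp [Finset.sum_mul]
    _ ≤ _ := by nlinarith

/-- Change of measure: weighting the root of a likelihood ratio by the denominator law gives the
Bhattacharyya summand. At `x = 0` both sides vanish. -/
theorem mul_sqrt_div_self {x y : ℝ} (hx : 0 ≤ x) : x * √(y / x) = √(x * y) := by
  rcases hx.eq_or_lt with rfl | hx
  · simp
  · rw [← Real.sqrt_sq hx.le, ← Real.sqrt_mul (sq_nonneg x), Real.sqrt_sq hx.le]
    congr 1
    field_simp

namespace Model

variable [NeZero K] (M : Model K S) (Λ : Fin K → SRS K S) (h h' : Fin K)

theorem sum_actLik (o : ℕ → Obs K S) (n : ℕ) :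
    ∑ u, (M.actLik Λ o (n + 1) u).toReal = 1 := by
  rw [← ENNReal.toReal_sum fun u _ => M.actLik_ne_top Λ o _ u]
  simp only [actLik]
  rw [Finset.sum_comm, ← Fintype.sum_prod_type (f := fun x => M.actionLaw Λ n o x),
    ← tsum_fintype (L := SummationFilter.unconditional _), PMF.tsum_coe, ENNReal.toReal_one]

/-- After the sweep, the trembling hand pulls every arm with probability at least `η / K`. -/
theorem le_sum_actLik (o : ℕ → Obs K S) {n : ℕ} (hn : K ≤ n + 1) (a : Fin K) :
    M.η / K ≤ ∑ b, (M.actLik Λ o (n + 1) (b, a)).toReal := by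
  have hη : 0 ≤ M.η := M.η_mem.1.le
  have hη' : 0 ≤ 1 - M.η := sub_nonneg.2 M.η_mem.2
  rw [← ENNReal.toReal_sum fun b _ => M.actLik_ne_top Λ o _ (b, a)]
  rw [← ENNReal.toReal_ofReal (div_nonneg hη (Nat.cast_nonneg K))]
  refine ENNReal.toReal_mono (ENNReal.sum_ne_top.2 fun b _ => M.actLik_ne_top Λ o _ (b, a)) ?_
  have htr : ∀ b, ENNReal.ofReal (M.η / K) ≤ M.tremble b a := fun b => by
    refine ENNReal.ofReal_le_ofReal (le_add_of_nonneg_right (mul_nonneg hη' ?_))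
    split_ifs <;> norm_num
  -- `p` is the joint law of the guess and the intended arm; the pulled arm is then drawn by the
  -- tremble alone, whose bound holds for every intended arm.
  set p : PMF (Fin K × Fin K) :=
    (PMF.uniformOfFinset (M.bestGuesses o n) (M.bestGuesses_nonempty o n)).bind fun θ =>
      (Λ θ (delayState o (n + 1))).map fun b => (θ, b)
  have hact : M.actionLaw Λ n o = p.bind fun q => (M.tremble q.2).map fun a => (q.1, q.2, a) := by
    rw [actionLaw, dif_neg (by omega), PMF.bind_bind]
    simp only [PMF.bind_map, Function.comp_def]
  have hval : ∀ q : Fin K × Fin K, M.actionLaw Λ n o (q.1, q.2, a) = p q * M.tremble q.2 a := by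
    intro q
    rw [hact, PMF.bind_apply, tsum_eq_single q, PMF.map_apply, tsum_eq_single a]
    · simp
    · intro a' ha'
      simp [ha'.symm]
    · intro q' hq'
      rw [PMF.map_apply]
      simp only [mul_eq_zero, ENNReal.tsum_eq_zero, ite_eq_right_iff]
      refine Or.inr fun a' ha' => ?_
      simp only [Prod.mk.injEq] at ha'
      exact absurd (Prod.ext ha'.1.symm ha'.2.1.symm) hq'
  simp only [actLik]
  rw [Finset.sum_comm]
  calc ENNReal.ofReal (M.η / K) = ∑ q, p q * ENNReal.ofReal (M.η / K) := by
        rw [← Finset.sum_mul, ← tsum_fintype (L := SummationFilter.unconditional _), p.tsum_coe,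
          one_mul]
    _ ≤ ∑ q, p q * M.tremble q.2 a := Finset.sum_le_sum fun q _ => mul_le_mul_right (htr q.2) _
    _ = ∑ θ, ∑ b, M.actionLaw Λ n o (θ, b, a) := by
        rw [Fintype.sum_prod_type]
        exact Finset.sum_congr rfl fun θ _ => Finset.sum_congr rfl fun b _ => (hval (θ, b)).symm

/-- The affinity of the conditional laws of the records at times `n + 1, …, n + m` given those at
times `≤ n`, when arm `h` and when arm `h'` is odd. -/
def affinity : ℕ → ℕ → (ℕ → Obs K S) → ℝ
  | 0, _, _ => 1
  | m + 1, n, o => ∑ u, (M.actLik Λ o (n + 1) u).toReal *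
      ∑ s, √((M.predLaw h o (n + 1) u.2 s).toReal * (M.predLaw h' o (n + 1) u.2 s).toReal) *
        affinity m (n + 1) (Function.update o (n + 1) (u.1, u.2, s))

theorem affinity_nonneg : ∀ (m n : ℕ) (o : ℕ → Obs K S), 0 ≤ M.affinity Λ h h' m n o
  | 0, _, _ => zero_le_one
  | m + 1, n, _ => Finset.sum_nonneg fun _ _ => mul_nonneg ENNReal.toReal_nonneg <|
      Finset.sum_nonneg fun _ _ => mul_nonneg (Real.sqrt_nonneg _) (affinity_nonneg m (n + 1) _)

theorem sum_sqrt_mul_affinity_le {m n : ℕ} {o : ℕ → Obs K S} {u : Fin K × Fin K} {e : ℝ}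
    (H : ∀ s, M.affinity Λ h h' m (n + 1) (Function.update o (n + 1) (u.1, u.2, s)) ≤ e) :
    ∑ s, √((M.predLaw h o (n + 1) u.2 s).toReal * (M.predLaw h' o (n + 1) u.2 s).toReal) *
      M.affinity Λ h h' m (n + 1) (Function.update o (n + 1) (u.1, u.2, s)) ≤
      bhattacharyya (M.predLaw h o (n + 1) u.2) (M.predLaw h' o (n + 1) u.2) * e := by
  rw [bhattacharyya, Finset.sum_mul]
  exact Finset.sum_le_sum fun s _ => mul_le_mul_of_nonneg_left (H s) (Real.sqrt_nonneg _)

theorem affinity_le_one : ∀ (m n : ℕ) (o : ℕ → Obs K S), M.affinity Λ h h' m n o ≤ 1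
  | 0, _, _ => le_rfl
  | m + 1, n, o => by
    rw [affinity, ← M.sum_actLik Λ o n]
    refine Finset.sum_le_sum fun u _ => mul_le_of_le_one_right ENNReal.toReal_nonneg ?_
    refine (M.sum_sqrt_mul_affinity_le Λ h h' (fun s => affinity_le_one m _ _)).trans ?_
    rw [mul_one]
    exact bhattacharyya_le_one _ _

theorem affinity_succ_le {m n : ℕ} {o : ℕ → Obs K S} (hn : K ≤ n + 1) (a : Fin K) {e : ℝ}
    (he : 0 ≤ e)
    (H : ∀ b, ∑ s, √((M.predLaw h o (n + 1) a s).toReal * (M.predLaw h' o (n + 1) a s).toReal) *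
      M.affinity Λ h h' m (n + 1) (Function.update o (n + 1) (b, a, s)) ≤ 1 - e) :
    M.affinity Λ h h' (m + 1) n o ≤ 1 - M.η / K * e := by
  refine sum_mul_le_one_sub (fun u => ENNReal.toReal_nonneg) (M.sum_actLik Λ o n) (fun u => ?_) he
    (b := a) H (M.le_sum_actLik Λ o hn a)
  refine (M.sum_sqrt_mul_affinity_le Λ h h' (fun s => M.affinity_le_one Λ h h' m _ _)).trans ?_
  rw [mul_one]
  exact bhattacharyya_le_one _ _

variable {h h'}

omit [NeZero K] in
theorem arm_self (M : Model K S) (a : Fin K) : M.arm a a = M.P₁ := if_pos rfl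

omit [NeZero K] in
theorem arm_of_ne (M : Model K S) {g a : Fin K} (hga : a ≠ g) : M.arm g a = M.P₂ := if_neg hga

omit [NeZero K] in
theorem predLaw_update (g : Fin K) (o : ℕ → Obs K S) (t : ℕ) (r : Obs K S) (a : Fin K) :
    M.predLaw g (Function.update o t r) (t + 1) a =
      (if a = r.2.1 then PMF.pure r.2.2 else M.predLaw g o t a).bind (rowPMF (M.arm g a)) := by
  rw [predLaw_succ, postLaw_update]

/-- The second of two consecutive pulls of `h`: its delay is `1`, so the comparison is between
single rows of `P₁` and `P₂`. -/
theorem affinity_one_le {i : S} {n : ℕ} {o : ℕ → Obs K S} (hn : K ≤ n + 1)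
    (h₁ : M.predLaw h o (n + 1) h = rowPMF M.P₁ i)
    (h₂ : M.predLaw h' o (n + 1) h = rowPMF M.P₂ i) :
    M.affinity Λ h h' 1 n o ≤
      1 - M.η / K * (1 - bhattacharyya (rowPMF M.P₁ i) (rowPMF M.P₂ i)) := by
  refine M.affinity_succ_le Λ h h' hn h (sub_nonneg.2 (bhattacharyya_le_one _ _)) fun b => ?_
  refine (M.sum_sqrt_mul_affinity_le Λ h h' (u := (b, h))
    (fun s => M.affinity_le_one Λ h h' 0 _ _)).trans ?_
  rw [h₁, h₂]
  linarith

/-- The first pull of `h` shows `i` with affinity weight at least `√(ε₁ * ε₂)`, and on that branch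
the next step loses `κ`. -/
theorem affinity_two_le (hh : h' ≠ h) {i : S} {n : ℕ} {o : ℕ → Obs K S} (hn : K ≤ n + 1)
    {ε₁ ε₂ : ℝ} (hε₂ : 0 ≤ ε₂) (h₁ : ε₁ ≤ (M.predLaw h o (n + 1) h i).toReal)
    (h₂ : ε₂ ≤ (M.predLaw h' o (n + 1) h i).toReal) :
    M.affinity Λ h h' 2 n o ≤ 1 - M.η / K * (√(ε₁ * ε₂) *
      (M.η / K * (1 - bhattacharyya (rowPMF M.P₁ i) (rowPMF M.P₂ i)))) := by
  set κ := M.η / K * (1 - bhattacharyya (rowPMF M.P₁ i) (rowPMF M.P₂ i))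
  have hκ : 0 ≤ κ := mul_nonneg (div_nonneg M.η_mem.1.le (Nat.cast_nonneg K))
    (sub_nonneg.2 (bhattacharyya_le_one _ _))
  refine M.affinity_succ_le Λ h h' hn h (mul_nonneg (Real.sqrt_nonneg _) hκ) fun b => ?_
  set w : S → ℝ := fun s =>
    √((M.predLaw h o (n + 1) h s).toReal * (M.predLaw h' o (n + 1) h s).toReal)
  have hwi : √(ε₁ * ε₂) ≤ w i :=
    Real.sqrt_le_sqrt (mul_le_mul h₁ h₂ hε₂ ENNReal.toReal_nonneg)
  have hw : ∑ s, w s ≤ 1 := bhattacharyya_le_one _ _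
  calc ∑ s, w s * M.affinity Λ h h' 1 (n + 1) (Function.update o (n + 1) (b, h, s))
      ≤ ∑ s, (w s - if s = i then w s * κ else 0) := by
        refine Finset.sum_le_sum fun s _ => ?_
        have hws : 0 ≤ w s := Real.sqrt_nonneg _
        split_ifs with hs
        · subst hs
          have := M.affinity_one_le Λ (h := h) (h' := h') (i := s) (n := n + 1)
            (o := Function.update o (n + 1) (b, h, s)) (by omega)
            (by rw [predLaw_update, if_pos rfl, PMF.pure_bind, arm_self])
            (by rw [predLaw_update, if_pos rfl, PMF.pure_bind, arm_of_ne M hh.symm])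
          nlinarith
        · have := M.affinity_le_one Λ h h' 1 (n + 1) (Function.update o (n + 1) (b, h, s))
          nlinarith
    _ = ∑ s, w s - w i * κ := by simp [Finset.sum_sub_distrib]
    _ ≤ 1 - √(ε₁ * ε₂) * κ := by nlinarith

/-- Each of the first `j` steps is spent on pulling `h'`, at the price of a factor `η / K`. Arm `h`
stays unobserved, so its two candidate laws just move by `P₁` and `P₂`. -/
theorem affinity_add_two_le (hh : h' ≠ h) {i : S} {ε₁ ε₂ : ℝ} (hε₂ : 0 ≤ ε₂) :
    ∀ (j n : ℕ) (o : ℕ → Obs K S), K ≤ n + 1 →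
    ε₁ ≤ ((M.predLaw h o (n + 1) h).bind (rowPMF (M.P₁ ^ j)) i).toReal →
    ε₂ ≤ ((M.predLaw h' o (n + 1) h).bind (rowPMF (M.P₂ ^ j)) i).toReal →
    M.affinity Λ h h' (j + 2) n o ≤ 1 - (M.η / K) ^ (j + 1) * (√(ε₁ * ε₂) *
      (M.η / K * (1 - bhattacharyya (rowPMF M.P₁ i) (rowPMF M.P₂ i))))
  | 0, n, o, hn, h₁, h₂ => by
    rw [pow_zero, bind_rowPMF_one] at h₁ h₂
    rw [zero_add, pow_one]
    exact M.affinity_two_le Λ hh hn hε₂ h₁ h₂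
  | j + 1, n, o, hn, h₁, h₂ => by
    have hη : 0 ≤ M.η / K := div_nonneg M.η_mem.1.le (Nat.cast_nonneg K)
    set e := (M.η / K) ^ (j + 1) * (√(ε₁ * ε₂) *
      (M.η / K * (1 - bhattacharyya (rowPMF M.P₁ i) (rowPMF M.P₂ i))))
    have he : 0 ≤ e := mul_nonneg (pow_nonneg hη _) (mul_nonneg (Real.sqrt_nonneg _)
      (mul_nonneg hη (sub_nonneg.2 (bhattacharyya_le_one _ _))))
    rw [pow_succ' _ (j + 1), mul_assoc]
    refine M.affinity_succ_le Λ h h' hn h' he fun b => ?_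
    have H : ∀ s, M.affinity Λ h h' (j + 2) (n + 1) (Function.update o (n + 1) (b, h', s)) ≤ 1 - e := by
      intro s
      refine affinity_add_two_le hh hε₂ j (n + 1) _ (by omega) ?_ ?_
      · rwa [predLaw_update, if_neg hh.symm, arm_self, ← bind_rowPMF_mul, ← pow_succ']
      · rwa [predLaw_update, if_neg hh.symm, arm_of_ne M hh.symm, ← bind_rowPMF_mul, ← pow_succ']
    -- Needed to drop the Bhattacharyya factor of the pull of `h'`; it follows from `H` at any
    -- state, as affinities are nonnegative.
    have he1 : 0 ≤ 1 - e := by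
      obtain ⟨s, -⟩ := (M.predLaw h o (n + 1) h).support_nonempty
      exact (M.affinity_nonneg Λ h h' _ _ _).trans (H s)
    exact (M.sum_sqrt_mul_affinity_le Λ h h' (u := (b, h')) H).trans
      (mul_le_of_le_one_left he1 (bhattacharyya_le_one _ _))

/-- The records of a long enough block of times distinguish `h` from `h'`, uniformly in the past. -/
theorem exists_affinity_le (hP₁ : IsErgodic (M.P₁ : Matrix S S ℝ))
    (hP₂ : IsErgodic (M.P₂ : Matrix S S ℝ)) (hne : M.P₁ ≠ M.P₂) (hh : h' ≠ h) :
    ∃ m > 0, ∃ ρ < 1, 0 ≤ ρ ∧ ∀ n ≥ K, ∀ o, M.affinity Λ h h' m n o ≤ ρ := by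
  obtain ⟨i, hi⟩ : ∃ i, rowPMF M.P₁ i ≠ rowPMF M.P₂ i := by
    by_contra! H
    refine hne (Subtype.ext (Matrix.ext fun i j => ?_))
    rw [← toReal_rowPMF, ← toReal_rowPMF, H]
  obtain ⟨N₁, hN₁⟩ := hP₁.eventually_pow_pos i
  obtain ⟨N₂, hN₂⟩ := hP₂.eventually_pow_pos i
  -- A common waiting time serves both chains, and the Doeblin bounds hold for all initial laws,
  -- hence uniformly in the past.
  obtain ⟨ε₁, hε₁, H₁⟩ := exists_le_bind_pow (hN₁ (max N₁ N₂) (le_max_left _ _))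
  obtain ⟨ε₂, hε₂, H₂⟩ := exists_le_bind_pow (hN₂ (max N₁ N₂) (le_max_right _ _))
  have hη : 0 < M.η / K := div_pos M.η_mem.1 (Nat.cast_pos.2 (NeZero.pos K))
  have hκ : 0 < 1 - bhattacharyya (rowPMF M.P₁ i) (rowPMF M.P₂ i) :=
    sub_pos.2 (bhattacharyya_lt_one hi)
  have H := fun n (hn : n ≥ K) o => M.affinity_add_two_le Λ hh hε₂.le (max N₁ N₂) n o
    (Nat.le_succ_of_le hn) (H₁ _) (H₂ _)
  refine ⟨max N₁ N₂ + 2, by omega, _, sub_lt_self 1 (by positivity), ?_, H⟩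
  exact (M.affinity_nonneg Λ h h' _ _ _).trans (H K le_rfl fun _ => (0, 0, i))

/-! ### The mean square root of the likelihood ratio along the trajectory. -/

variable (h h') in
/-- The square root of the likelihood ratio of `h'` against `h`. -/
def sqrtRatio (o : ℕ → Obs K S) (n : ℕ) : ℝ :=
  ∏ t ∈ Finset.range (n + 1), √((M.predLaw h' o t (o t).2.1 (o t).2.2).toReal /
    (M.predLaw h o t (o t).2.1 (o t).2.2).toReal)

omit [NeZero K] in
theorem sqrtRatio_nonneg (o : ℕ → Obs K S) (n : ℕ) : 0 ≤ M.sqrtRatio h h' o n :=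
  Finset.prod_nonneg fun _ _ => Real.sqrt_nonneg _

omit [NeZero K] in
theorem sqrtRatio_congr {o o' : ℕ → Obs K S} {n : ℕ} (H : ∀ t ≤ n, o t = o' t) :
    M.sqrtRatio h h' o n = M.sqrtRatio h h' o' n := by
  refine Finset.prod_congr rfl fun t ht => ?_
  have ht' : t ≤ n := by simpa [Nat.lt_succ_iff] using ht
  rw [predLaw_congr M h fun i hi => H i (by omega), predLaw_congr M h' fun i hi => H i (by omega),
    H t ht']

theorem affinity_congr : ∀ {m n : ℕ} {o o' : ℕ → Obs K S}, (∀ t ≤ n, o t = o' t) →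
    M.affinity Λ h h' m n o = M.affinity Λ h h' m n o'
  | 0, _, _, _, _ => rfl
  | m + 1, n, o, o', H => by
    rw [affinity, affinity, actLik_congr M Λ fun i hi => H i (Nat.lt_succ_iff.1 hi),
      predLaw_congr M h fun i hi => H i (Nat.lt_succ_iff.1 hi),
      predLaw_congr M h' fun i hi => H i (Nat.lt_succ_iff.1 hi)]
    exact Finset.sum_congr rfl fun u _ => congrArg _ <| Finset.sum_congr rfl fun s _ =>
      congrArg _ <| affinity_congr (update_congr H _)

variable [MeasurableSpace S] [MeasurableSingletonClass S]

/-- Integrating out the record at time `n + 1` turns its likelihood ratio factor into one more layer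
of the affinity; iterated, this gives `meanSqrtRatio_add`. -/
theorem lintegral_sqrtRatio_affinity_succ (m n : ℕ) :
    ∫⁻ ω, ENNReal.ofReal (M.sqrtRatio h h' (records ω) (n + 1) *
        M.affinity Λ h h' m (n + 1) (records ω)) ∂M.law Λ h =
      ∫⁻ ω, ENNReal.ofReal (M.sqrtRatio h h' (records ω) n *
        M.affinity Λ h h' (m + 1) n (records ω)) ∂M.law Λ h := by
  rw [lintegral_records_succ' M Λ h (n := n) (f := fun o => ENNReal.ofReal
    (M.sqrtRatio h h' o (n + 1) * M.affinity Λ h h' m (n + 1) o)) fun o o' H => by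
      dsimp only; rw [sqrtRatio_congr M H, affinity_congr M Λ H]]
  refine lintegral_congr fun ω => ?_
  set o := records ω
  have hlt : ∀ r : Obs K S, ∀ i < n + 1, Function.update o (n + 1) r i = o i :=
    fun r i hi => Function.update_of_ne hi.ne _ _
  have hterm : ∀ r : Obs K S, M.recLik Λ h (Function.update o (n + 1) r) (n + 1) *
      ENNReal.ofReal (M.sqrtRatio h h' (Function.update o (n + 1) r) (n + 1) *
        M.affinity Λ h h' m (n + 1) (Function.update o (n + 1) r)) =
      ENNReal.ofReal (M.sqrtRatio h h' o n * ((M.actLik Λ o (n + 1) (r.1, r.2.1)).toReal *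
        (√((M.predLaw h o (n + 1) r.2.1 r.2.2).toReal *
          (M.predLaw h' o (n + 1) r.2.1 r.2.2).toReal) *
          M.affinity Λ h h' m (n + 1) (Function.update o (n + 1) r)))) := by
    intro r
    rw [recLik, sqrtRatio, Finset.prod_range_succ, ← sqrtRatio,
      sqrtRatio_congr M fun t ht => hlt r t (Nat.lt_succ_of_le ht)]
    simp only [Function.update_self, actLik_congr M Λ (hlt r), predLaw_congr M _ (hlt r)]
    rw [← ENNReal.ofReal_toReal (M.actLik_ne_top Λ o (n + 1) (r.1, r.2.1)),
      ← ENNReal.ofReal_toReal (PMF.apply_ne_top (M.predLaw h o (n + 1) r.2.1) r.2.2),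
      ← ENNReal.ofReal_mul ENNReal.toReal_nonneg, ← ENNReal.ofReal_mul (by positivity),
      ← mul_sqrt_div_self ENNReal.toReal_nonneg]
    simp only [ENNReal.toReal_ofReal ENNReal.toReal_nonneg]
    congr 1
    ring
  simp only [hterm]
  rw [← ENNReal.ofReal_sum_of_nonneg]
  · congr 1
    rw [← Finset.mul_sum, affinity]
    congr 1
    simp only [Fintype.sum_prod_type, Finset.mul_sum]
  · exact fun r _ => mul_nonneg (M.sqrtRatio_nonneg _ _) (mul_nonneg ENNReal.toReal_nonneg
      (mul_nonneg (Real.sqrt_nonneg _) (M.affinity_nonneg Λ h h' _ _ _)))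

variable (h h') in
/-- The expected square root of the likelihood ratio. -/
def meanSqrtRatio (n : ℕ) : ℝ≥0∞ :=
  ∫⁻ ω, ENNReal.ofReal (M.sqrtRatio h h' (records ω) n) ∂M.law Λ h

theorem meanSqrtRatio_add (m : ℕ) : ∀ n : ℕ, M.meanSqrtRatio Λ h h' (n + m) =
    ∫⁻ ω, ENNReal.ofReal (M.sqrtRatio h h' (records ω) n *
      M.affinity Λ h h' m n (records ω)) ∂M.law Λ h := by
  induction m with
  | zero => simp [meanSqrtRatio, affinity]
  | succ m ih =>
    intro n
    rw [← lintegral_sqrtRatio_affinity_succ, ← ih (n + 1)]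
    congr 1
    ring

theorem meanSqrtRatio_add_le {m n : ℕ} {ρ : ℝ} (hρ : 0 ≤ ρ)
    (H : ∀ o, M.affinity Λ h h' m n o ≤ ρ) :
    M.meanSqrtRatio Λ h h' (n + m) ≤ ENNReal.ofReal ρ * M.meanSqrtRatio Λ h h' n := by
  rw [meanSqrtRatio_add, meanSqrtRatio, ← lintegral_const_mul' _ _ ENNReal.ofReal_ne_top]
  refine lintegral_mono fun ω => ?_
  rw [← ENNReal.ofReal_mul hρ, mul_comm ρ]
  exact ENNReal.ofReal_le_ofReal
    (mul_le_mul_of_nonneg_left (H _) (M.sqrtRatio_nonneg _ _))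

instance (g : Fin K) : IsProbabilityMeasure (M.law Λ g) := by
  unfold law
  infer_instance

theorem meanSqrtRatio_zero_le : M.meanSqrtRatio Λ h h' 0 ≤ 1 := by
  calc M.meanSqrtRatio Λ h h' 0 ≤ ∫⁻ _, 1 ∂M.law Λ h := by
        refine lintegral_mono fun ω => ?_
        rw [← ENNReal.ofReal_one]
        refine ENNReal.ofReal_le_ofReal ?_
        simp only [sqrtRatio, zero_add, Finset.prod_range_one, predLaw]
        exact Real.sqrt_le_one.2 (div_self_le_one _)
    _ = 1 := by simp

theorem meanSqrtRatio_antitone : Antitone (M.meanSqrtRatio Λ h h') :=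
  antitone_nat_of_succ_le fun n => by
    simpa using M.meanSqrtRatio_add_le Λ (m := 1) zero_le_one
      fun o => M.affinity_le_one Λ h h' 1 n o

end Model

theorem exists_geometric_bound {v : ℕ → ℝ} (hv : Antitone v) (hv₁ : v 0 ≤ 1) (hv₀ : ∀ n, 0 ≤ v n)
    {k m : ℕ} (hm : 0 < m) {ρ : ℝ} (hρ : ρ < 1) (H : ∀ n ≥ k, v (n + m) ≤ ρ * v n) :
    ∃ C r : ℝ, 0 < r ∧ r < 1 ∧ 0 ≤ C ∧ ∀ n, v n ≤ C * r ^ n := by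
  -- The maximum keeps the base of the `m`-th root positive, also when `ρ ≤ 0`.
  set σ := max ρ (1 / 2)
  have hσ : 0 < σ := lt_max_of_lt_right (by norm_num)
  have hσ₁ : σ < 1 := max_lt hρ (by norm_num)
  have hr₀ : 0 < σ ^ (1 / (m : ℝ)) := Real.rpow_pos_of_pos hσ _
  have hr₁ : σ ^ (1 / (m : ℝ)) < 1 :=
    Real.rpow_lt_one hσ.le hσ₁ (one_div_pos.2 (Nat.cast_pos.2 hm))
  have hrm : (σ ^ (1 / (m : ℝ))) ^ m = σ := by
    rw [one_div, Real.rpow_inv_natCast_pow hσ.le hm.ne']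
  set r := σ ^ (1 / (m : ℝ))
  -- With this constant the bound is at least `1` for `n < k + m`, where only `v n ≤ 1` is
  -- available; later, `m` steps gain the factor `r ^ m = σ`.
  refine ⟨(r ^ (k + m))⁻¹, r, hr₀, hr₁, by positivity, fun n => ?_⟩
  induction n using Nat.strong_induction_on with
  | _ n ih =>
    rcases lt_or_ge n (k + m) with hn | hn
    · calc v n ≤ 1 := (hv (Nat.zero_le n)).trans hv₁
        _ ≤ (r ^ (k + m))⁻¹ * r ^ n := by
          rw [inv_mul_eq_div, one_le_div (by positivity)]
          exact pow_le_pow_of_le_one hr₀.le hr₁.le hn.le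
    · obtain ⟨j, rfl⟩ := Nat.exists_eq_add_of_le' (show m ≤ n by omega)
      calc v (j + m) ≤ ρ * v j := H j (by omega)
        _ ≤ σ * v j := mul_le_mul_of_nonneg_right (le_max_left _ _) (hv₀ j)
        _ ≤ σ * ((r ^ (k + m))⁻¹ * r ^ j) := mul_le_mul_of_nonneg_left (ih j (by omega)) hσ.le
        _ = _ := by rw [← hrm]; ring

end OddArm

namespace OddArm

variable {K : ℕ} {S : Type*} [Fintype S] [DecidableEq S]
  [MeasurableSpace S] [MeasurableSingletonClass S]

/-! ### Linear growth of the statistics and termination of the policy -/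

namespace Model

variable [NeZero K] (M : Model K S) (Λ : Fin K → SRS K S) {h h' : Fin K}

/-- Markov's inequality at level `√r ^ n`: half of the exponential decay is spent on the threshold,
the other half makes the probabilities summable when `r < 1`. -/
theorem law_le_sqrtRatio_le {C r : ℝ} (hr : 0 < r) {n : ℕ}
    (hC : (M.meanSqrtRatio Λ h h' n) ≤ ENNReal.ofReal (C * r ^ n)) :
    M.law Λ h {ω | √r ^ n ≤ M.sqrtRatio h h' (records ω) n} ≤ ENNReal.ofReal (C * √r ^ n) := by
  have hs : 0 < √r ^ n := pow_pos (Real.sqrt_pos.2 hr) n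
  have hmeas : Measurable fun ω : ℕ → Config K S =>
      ENNReal.ofReal (M.sqrtRatio h h' (records ω) n) :=
    measurable_of_dependsOn (n := n) (dependsOn_comp_records
      (f := fun o => ENNReal.ofReal (M.sqrtRatio h h' o n))
      fun o o' H => by dsimp only; rw [sqrtRatio_congr M H])
  have hmarkov := (mul_meas_ge_le_lintegral (μ := M.law Λ h) hmeas
    (ENNReal.ofReal (√r ^ n))).trans hC
  simp only [ENNReal.ofReal_le_ofReal_iff (M.sqrtRatio_nonneg _ _)] at hmarkov
  have hsplit : ENNReal.ofReal (C * r ^ n) =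
      ENNReal.ofReal (√r ^ n) * ENNReal.ofReal (C * √r ^ n) := by
    rw [← ENNReal.ofReal_mul hs.le]
    congr 1
    calc C * r ^ n = C * (√r * √r) ^ n := by rw [Real.mul_self_sqrt hr.le]
      _ = _ := by ring
  rw [hsplit] at hmarkov
  exact (ENNReal.mul_le_mul_iff_right (ENNReal.ofReal_pos.2 hs).ne' ENNReal.ofReal_ne_top).1 hmarkov

theorem ae_eventually_sqrtRatio_lt (hP₁ : IsErgodic (M.P₁ : Matrix S S ℝ))
    (hP₂ : IsErgodic (M.P₂ : Matrix S S ℝ)) (hne : M.P₁ ≠ M.P₂) (hh : h' ≠ h) :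
    ∃ r : ℝ, 0 < r ∧ r < 1 ∧
      ∀ᵐ ω ∂M.law Λ h, ∀ᶠ n in atTop, M.sqrtRatio h h' (records ω) n < √r ^ n := by
  obtain ⟨m, hm, ρ, hρ, hρ₀, H⟩ := M.exists_affinity_le Λ hP₁ hP₂ hne hh
  have hanti := M.meanSqrtRatio_antitone Λ (h := h) (h' := h')
  have hle : ∀ n, M.meanSqrtRatio Λ h h' n ≤ 1 := fun n =>
    (hanti (Nat.zero_le n)).trans (M.meanSqrtRatio_zero_le Λ)
  have htop : ∀ n, M.meanSqrtRatio Λ h h' n ≠ ∞ := fun n =>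
    ((hle n).trans_lt ENNReal.one_lt_top).ne
  obtain ⟨C, r, hr, hr₁, hC, hv⟩ := exists_geometric_bound
    (v := fun n => (M.meanSqrtRatio Λ h h' n).toReal)
    (fun a b hab => ENNReal.toReal_mono (htop a) (hanti hab))
    (ENNReal.toReal_le_of_le_ofReal zero_le_one (by simpa using hle 0))
    (fun _ => ENNReal.toReal_nonneg) hm hρ (k := K) (fun n hn => by
      rw [← ENNReal.toReal_ofReal hρ₀, ← ENNReal.toReal_mul]
      exact ENNReal.toReal_mono (ENNReal.mul_ne_top ENNReal.ofReal_ne_top (htop n))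
        (M.meanSqrtRatio_add_le Λ hρ₀ (H n hn)))
  refine ⟨r, hr, hr₁, ?_⟩
  have hsum : ∑' n, M.law Λ h {ω | √r ^ n ≤ M.sqrtRatio h h' (records ω) n} ≠ ∞ := by
    refine ne_top_of_le_ne_top ?_ (ENNReal.tsum_le_tsum fun n =>
      M.law_le_sqrtRatio_le Λ hr ((ENNReal.le_ofReal_iff_toReal_le (htop n) (by positivity)).2 (hv n)))
    have hsm : Summable fun n : ℕ => C * √r ^ n :=
      (summable_geometric_of_lt_one (Real.sqrt_nonneg r)
        ((Real.sqrt_lt' one_pos).2 (by rwa [one_pow]))).mul_left C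
    exact hsm.tsum_ofReal_ne_top
  filter_upwards [ae_eventually_notMem hsum] with ω hω
  filter_upwards [hω] with n hn
  simpa using hn

omit [MeasurableSpace S] [MeasurableSingletonClass S] in
theorem statZ_eq_neg_two_mul_log
    (hsupp : ∀ i j : S, 0 < (M.P₁ : Matrix S S ℝ) i j ↔ 0 < (M.P₂ : Matrix S S ℝ) i j)
    {o : ℕ → Obs K S} (ho : ∀ t, M.recLik Λ h o t ≠ 0) (n : ℕ) :
    0 < M.sqrtRatio h h' o n ∧ M.statZ h h' o n = -2 * Real.log (M.sqrtRatio h h' o n) := by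
  have hpos : ∀ t, 0 < (M.predLaw h' o t (o t).2.1 (o t).2.2).toReal /
      (M.predLaw h o t (o t).2.1 (o t).2.2).toReal := fun t =>
    div_pos (ENNReal.toReal_nonneg.lt_of_ne' (M.predLaw_toReal_ne_zero Λ hsupp (ho t) h'))
      (ENNReal.toReal_nonneg.lt_of_ne' (M.predLaw_toReal_ne_zero Λ hsupp (ho t) h))
  refine ⟨Finset.prod_pos fun t _ => Real.sqrt_pos.2 (hpos t), ?_⟩
  rw [statZ_eq_of_isSweep M h h' (isSweep_of_recLik_ne_zero M Λ h ho), sqrtRatio,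
    Real.log_prod fun t _ => (Real.sqrt_pos.2 (hpos t)).ne', Finset.mul_sum]
  refine Finset.sum_congr rfl fun t _ => ?_
  rw [Real.log_sqrt (hpos t).le, ← inv_div, Real.log_inv]
  ring

theorem ae_eventually_le_statZ (hP₁ : IsErgodic (M.P₁ : Matrix S S ℝ))
    (hP₂ : IsErgodic (M.P₂ : Matrix S S ℝ)) (hne : M.P₁ ≠ M.P₂)
    (hsupp : ∀ i j : S, 0 < (M.P₁ : Matrix S S ℝ) i j ↔ 0 < (M.P₂ : Matrix S S ℝ) i j)
    (hh : h' ≠ h) :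
    ∃ c : ℝ, 0 < c ∧ ∀ᵐ ω ∂M.law Λ h, ∀ᶠ n : ℕ in atTop, c * n ≤ M.statZ h h' (records ω) n := by
  obtain ⟨r, hr, hr₁, H⟩ := M.ae_eventually_sqrtRatio_lt Λ hP₁ hP₂ hne hh
  refine ⟨-Real.log r, neg_pos.2 (Real.log_neg hr hr₁), ?_⟩
  filter_upwards [H, M.ae_recLik Λ h] with ω hω hrec
  filter_upwards [hω] with n hn
  obtain ⟨hpos, hZ⟩ := M.statZ_eq_neg_two_mul_log Λ (h' := h') hsupp hrec n
  have := Real.log_le_log hpos hn.le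
  rw [Real.log_pow, Real.log_sqrt hr.le] at this
  rw [hZ]
  linarith

/-- After the sweep the guess maximises the test statistic. -/
theorem ae_guess_mem (n : ℕ) (hn : K ≤ n + 1) :
    ∀ᵐ ω ∂M.law Λ h, Config.guess (ω (n + 1)) ∈ M.bestGuesses (records ω) n := by
  classical
  have hrec : ∀ {ω ω' : ℕ → Config K S}, (∀ t ≤ n, ω t = ω' t) →
      M.bestGuesses (records ω) n = M.bestGuesses (records ω') n := fun H =>
    bestGuesses_congr M fun t ht => by rw [records, records, H t ht]
  have hdep : DependsOn (fun ω : ℕ → Config K S =>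
      if Config.guess (ω (n + 1)) ∈ M.bestGuesses (records ω) n then (0 : ℝ≥0∞) else 1)
      (Set.Iic (n + 1)) := by
    intro ω ω' H
    dsimp only
    rw [hrec fun t ht => H t (Set.mem_Iic.2 (by omega)), H (n + 1) (Set.mem_Iic.2 le_rfl)]
  have hzero : ∫⁻ ω, (if Config.guess (ω (n + 1)) ∈ M.bestGuesses (records ω) n
      then (0 : ℝ≥0∞) else 1) ∂M.law Λ h = 0 := by
    rw [lintegral_law_succ M Λ h hdep]
    have hint : ∀ ω : ℕ → Config K S, ∑ u, M.actionLaw Λ n (records ω) u *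
        ∑ y : Fin K → S, (∏ a, rowPMF (M.arm h a) ((ω n).1 a) (y a)) *
          (if Config.guess (Function.update ω (n + 1) (y, u) (n + 1)) ∈
            M.bestGuesses (records (Function.update ω (n + 1) (y, u))) n
            then (0 : ℝ≥0∞) else 1) = 0 := by
      intro ω
      refine Finset.sum_eq_zero fun u _ => ?_
      by_cases hu : M.actionLaw Λ n (records ω) u = 0
      · rw [hu, zero_mul]
      · have hmem : u.1 ∈ M.bestGuesses (records ω) n := by
          rw [← ne_eq, ← PMF.mem_support_iff, actionLaw, dif_neg (by omega)] at hu
          simp only [PMF.mem_support_bind_iff, PMF.mem_support_map_iff,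
            PMF.mem_support_uniformOfFinset_iff] at hu
          obtain ⟨θ, hθ, b, -, a, -, rfl⟩ := hu
          exact hθ
        refine mul_eq_zero_of_right _ (Finset.sum_eq_zero fun y _ => ?_)
        rw [hrec (ω' := ω) fun t ht => Function.update_of_ne (by omega) _ _, Function.update_self,
          if_pos (show Config.guess (y, u) ∈ _ from hmem), mul_zero]
    simp only [hint, lintegral_zero]
  rw [lintegral_eq_zero_iff (measurable_of_dependsOn hdep)] at hzero
  filter_upwards [hzero] with ω hω
  by_contra hmem
  simp [hmem] at hω

omit [NeZero K] [MeasurableSpace S] [MeasurableSingletonClass S] in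
theorem tendsto_statM (hK : 2 ≤ K) {o : ℕ → Obs K S}
    (H : ∀ h' ≠ h, Tendsto (M.statZ h h' o) atTop atTop) : Tendsto (M.statM h o) atTop atTop := by
  have : Nontrivial (Fin K) := Fin.nontrivial_iff_two_le.2 hK
  obtain ⟨g, hg⟩ := exists_ne h
  -- Over an empty index the real infimum would be `0`, so a second arm is needed.
  have : Nonempty {g' : Fin K // g' ≠ h} := ⟨⟨g, hg⟩⟩
  refine tendsto_atTop.2 fun x => ?_
  filter_upwards [eventually_all.2 fun g' : {g' : Fin K // g' ≠ h} =>
    tendsto_atTop.1 (H g' g'.2) x] with n hn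
  exact le_ciInf hn

omit [NeZero K] [MeasurableSpace S] [MeasurableSingletonClass S] in
theorem stopTime_lt_top {L : ℝ} {ω : ℕ → Config K S}
    (hM : Tendsto (M.statM h (records ω)) atTop atTop)
    (hguess : ∀ n, K ≤ n + 1 → Config.guess (ω (n + 1)) ∈ M.bestGuesses (records ω) n) :
    M.stopTime L ω < ⊤ := by
  obtain ⟨n, hn, hnK⟩ := ((tendsto_atTop.1 hM (Real.log (((K : ℝ) - 1) * L))).and
    (eventually_ge_atTop K)).exists
  -- The decision at time `n + 1` uses the statistics up to time `n`, and there the guess does at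
  -- least as well as `h`.
  refine iInf_lt_iff.2 ⟨n + 1, iInf_lt_iff.2 ⟨⟨by omega, hn.trans ?_⟩, ENat.natCast_lt_top _⟩⟩
  exact (M.mem_bestGuesses _ _ _).1 (hguess n (by omega)) h

end Model

end OddArm

end

theorem mainTheorem6 {K : ℕ} [NeZero K] (hK : 3 ≤ K)
    {S : Type*} [Fintype S] [DecidableEq S] [MeasurableSpace S] [MeasurableSingletonClass S]
    (M : OddArm.Model K S)
    (hP₁ : OddArm.IsErgodic (M.P₁ : Matrix S S ℝ))
    (hP₂ : OddArm.IsErgodic (M.P₂ : Matrix S S ℝ))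
    (hne : M.P₁ ≠ M.P₂)
    (hsupp : ∀ i j : S,
      0 < (M.P₁ : Matrix S S ℝ) i j ↔ 0 < (M.P₂ : Matrix S S ℝ) i j)
    (L : ℝ) (hL : 1 < L) (δ : ℝ) (hδ : 0 < δ)
    (Λ : Fin K → OddArm.SRS K S) (hΛ : ∀ g, M.IsNearOptimal g δ (Λ g))
    (h : Fin K) :
    (∀ᵐ ω ∂(M.law Λ h), ∀ g g' : Fin K, ∀ n : ℕ,
      M.logLikRatio Λ g g' n ω = M.statZ g g' (OddArm.records ω) n) ∧
    (∀ h' : Fin K, h' ≠ h → ∀ᵐ ω ∂(M.law Λ h),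
      0 < liminf (fun n : ℕ => ((M.logLikRatio Λ h h' n ω / n : ℝ) : EReal)) atTop) ∧
    (∀ᵐ ω ∂(M.law Λ h), M.stopTime L ω < ⊤) := by
  have hgrowth := fun h' (hh : h' ≠ h) => M.ae_eventually_le_statZ Λ hP₁ hP₂ hne hsupp hh
  refine ⟨?_, fun h' hh => ?_, ?_⟩
  · filter_upwards [M.ae_recLik Λ h] with ω hω g g' n
    exact M.logLikRatio_eq_statZ Λ hsupp hω g g' n
  · obtain ⟨c, hc, H⟩ := hgrowth h' hh
    filter_upwards [H, M.ae_recLik Λ h] with ω hω hrec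
    refine lt_of_lt_of_le (EReal.coe_pos.2 hc) (le_liminf_of_le (by isBoundedDefault) ?_)
    filter_upwards [hω, eventually_gt_atTop 0] with n hn hn₀
    rw [M.logLikRatio_eq_statZ Λ hsupp hrec, EReal.coe_le_coe_iff, le_div_iff₀ (Nat.cast_pos.2 hn₀)]
    exact hn
  · have hZ : ∀ᵐ ω ∂M.law Λ h, ∀ h' : {h' : Fin K // h' ≠ h},
        Tendsto (M.statZ h h' (OddArm.records ω)) atTop atTop := by
      refine ae_all_iff.2 fun h' => ?_
      obtain ⟨c, hc, H⟩ := hgrowth h' h'.2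
      filter_upwards [H] with ω hω
      exact tendsto_atTop_mono' _ hω (tendsto_natCast_atTop_atTop.const_mul_atTop hc)
    have hguess := ae_all_iff.2 fun n => ae_all_iff.2 fun hn => M.ae_guess_mem Λ (h := h) n hn
    filter_upwards [hZ, hguess] with ω hω hg
    exact M.stopTime_lt_top (M.tendsto_statM (by omega) fun h' hh => hω ⟨h', hh⟩) hg
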